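/- Let $\mathbb R_+=(0,\infty)$, let $f\colon\mathbb R_+\to\mathbb R$ be strictly increasing and concave with $f(1)=0$, and put $E(x,y):=f(x/y)$ for $x,y>0$. Then $E$ is a deviation on $\mathbb R_+$: $E(x,x)=0$, and $y\mapsto E(x,y)$ is continuous and strictly decreasing for every $x>0$. For $x\in\mathbb R_+^n$ and weights $\lambda_1,\dots,\lambda_n\ge 0$ with positive sum, let $\mathscr D_E(x,\lambda)$ be the unique $y>0$ with $\sum_i\lambda_iE(x_i,y)=0$. For a simple function $g\colon[0,1)\to\mathbb R_+$, constant with value $v_i$ on each cell $D_i$ of a finite partition of $[0,1)$ into intervals $[a,b)$, put $\mathscr D_E(g):=\mathscr D_E\big((v_1,\dots,v_n),(|D_1|,\dots,|D_n|)\big)$. For $t>0$ and an integrable $h\colon[0,t)\to\mathbb R_+$, let $\tilde h(x):=h(tx)$ for $x\in[0,1)$, and for $\varepsilon>0$ let $B_\varepsilon(\tilde h)$ be the set of simple functions $g\colon[0,1)\to\mathbb R_+$ with $\|g-\tilde h\|_1<\varepsilon$ and $|\mathrm{Rg}(g)\setminus\mathrm{Rg}(\tilde h)|<\varepsilon$,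 where $\mathrm{Rg}$ denotes the smallest closed interval containing the range and $|\cdot|$ Lebesgue measure. Put $$\mathscr D_E^L(h):=\lim_{\varepsilon\to0}\inf_{g\in B_\varepsilon(\tilde h)}\mathscr D_E(g),\qquad \mathscr D_E^U(h):=\lim_{\varepsilon\to0}\sup_{g\in B_\varepsilon(\tilde h)}\mathscr D_E(g).$$ The integral deviation mean $\mathscr D_E^0(h)$ is well defined if $\mathscr D_E^L(h)=\mathscr D_E^U(h)$, and it is then this common value. Let $\mathcal L_C$ be the class of all integrable $h\colon[0,t)\to\mathbb R_+$, $t>0$, with values in some interval whose closure in $\mathbb R$ is contained in $(0,\infty)$, and with $\operatorname{ess\,sup}h=\sup h$ and $\operatorname{ess\,inf}h=\inf h$. Then $\mathscr D_E^0$ is well defined on $\mathcal L_C$. Now take as the domain of $\mathscr D_E^0$ any class $X\supseteq\mathcal L_C$ of integrable functions $h\colon[0,t)\to\mathbb R_+$, $t>0$, on which $\mathscr D_E^0$ is well defined (for example $\mathcal L_C$ itself, or the largest such class). Let the integral Hardy constant $\mathcal H$ of $\mathscr D_E^0$ be the smallest $C\in[0,\infty]$ such that $$\int_0^\infty\mathscr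 D_E^0\big(u|_{[0,t)}\big)\,dt\le C\int_0^\infty u(t)\,dt$$ for every integrable $u\colon[0,\infty)\to\mathbb R_+$ with $u|_{[0,t)}\in X$ for all $t>0$; the mean $\mathscr D_E^0$ is called Hardy if $\mathcal H<\infty$. Then $\mathscr D_E^0$ is Hardy if and only if $$\int_0^1 f\big(\tfrac1t\big)\,dt<\infty .$$ If this holds, then there is exactly one $c>0$ with $$\int_0^c f\big(\tfrac1t\big)\,dt=0$$ (in particular the integral converges), and $\mathcal H=c$. -/

import Mathlib

open Set MeasureTheory
open scoped ENNReal

noncomputable section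

namespace IntegralHardy

/-- `E` is a deviation on the interval `I`: it vanishes on the diagonal, and every `E x` is
continuous and strictly decreasing on `I`. -/
def IsDeviation (I : Set ℝ) (E : ℝ → ℝ → ℝ) : Prop :=
  (∀ x ∈ I, E x x = 0) ∧ ∀ x ∈ I, ContinuousOn (E x) I ∧ StrictAntiOn (E x) I

/-- Values of an `ℝ`-weighted mean: `M n x w` is the mean of the entries `x` with weights `w`. -/
abbrev WeightedMean := (n : ℕ) → (Fin n → ℝ) → (Fin n → ℝ) → ℝ

/-- The weighted deviation mean: the (for a deviation unique) solution `y ∈ I` of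
`∑ i, w i * E (x i) y = 0`. -/
def deviationMean (I : Set ℝ) (E : ℝ → ℝ → ℝ) : WeightedMean := fun n x w =>
  Classical.epsilon fun y : ℝ => y ∈ I ∧ ∑ i : Fin n, w i * E (x i) y = 0

/-- A simple function `[a, b) → I`: constant on each cell of a finite partition
`a = pt 0 < pt 1 < ⋯ < pt n = b` into half-open intervals. The values of `toFun` outside `[a, b)`
play no role. -/
structure SimpleFn (I : Set ℝ) (a b : ℝ) where
  n : ℕ
  pt : Fin (n + 1) → ℝ
  pt_strictMono : StrictMono pt
  pt_zero : pt 0 = a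
  pt_last : pt (Fin.last n) = b
  val : Fin n → ℝ
  val_mem : ∀ i, val i ∈ I
  toFun : ℝ → ℝ
  toFun_eq : ∀ i : Fin n, ∀ x ∈ Ico (pt i.castSucc) (pt i.succ), toFun x = val i

/-- The mean of a simple function: the weighted mean of its values, weighted by the lengths of
the cells. -/
def SimpleFn.mean {I : Set ℝ} {a b : ℝ} (M : WeightedMean) (g : SimpleFn I a b) : ℝ :=
  M g.n g.val fun i => g.pt i.succ - g.pt i.castSucc

/-- The smallest closed interval that contains the values of `h` on `[0, 1)`. -/
def valueRange (h : ℝ → ℝ) : Set ℝ :=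
  closure (convexHull ℝ (h '' Ico 0 1))

/-- The simple functions `g : [0, 1) → I` that are `ε`-close to `h`: the part of the value range of
`g` outside that of `h` has length less than `ε`, and the `L¹` distance is less than `ε`. -/
def vicinity (I : Set ℝ) (h : ℝ → ℝ) (ε : ℝ) : Set (SimpleFn I 0 1) :=
  {g | volume (valueRange g.toFun \ valueRange h) < ENNReal.ofReal ε ∧
    ∫⁻ x in Ico 0 1, ENNReal.ofReal |h x - g.toFun x| < ENNReal.ofReal ε}

/-- The function `f` restricted to `[0, t)`, transported to `[0, 1)` by the increasing affine
bijection. -/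
def rescale (f : ℝ → ℝ) (t : ℝ) : ℝ → ℝ := fun x => f (t * x)

/-- The lower mean of `f` on `[0, t)`: the limit, as `ε` decreases to `0`, of the infimum of the means
of the simple functions `ε`-close to the rescaled function. (The infimum is monotone in `ε`, so
the limit is a supremum.) -/
def lowerMean (M : WeightedMean) (I : Set ℝ) (f : ℝ → ℝ) (t : ℝ) : EReal :=
  ⨆ (ε : ℝ) (_ : 0 < ε), ⨅ g ∈ vicinity I (rescale f t) ε, ((g.mean M : ℝ) : EReal)

/-- The upper mean of `f` on `[0, t)`. -/
def upperMean (M : WeightedMean) (I : Set ℝ) (f : ℝ → ℝ) (t : ℝ) : EReal :=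
  ⨅ (ε : ℝ) (_ : 0 < ε), ⨆ g ∈ vicinity I (rescale f t) ε, ((g.mean M : ℝ) : EReal)

/-- The functions `f` whose restriction to `[0, t)` is an integrable function with values in `I`. -/
def integrableClass (I : Set ℝ) (t : ℝ) : Set (ℝ → ℝ) :=
  {f | IntegrableOn f (Ico 0 t) ∧ ∀ x ∈ Ico 0 t, f x ∈ I}

/-- The functions `f` for which the integral mean generated by `M` is well defined on `[0, t)`:
lower and upper mean coincide. -/
def meanDomain (M : WeightedMean) (I : Set ℝ) (t : ℝ) : Set (ℝ → ℝ) :=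
  {f | f ∈ integrableClass I t ∧ lowerMean M I f t = upperMean M I f t}

/-- The integral mean of `f` on `[0, t)` generated by `M`, meaningful for `f ∈ meanDomain M I t`:
the common value of lower and upper mean. -/
def integralMean (M : WeightedMean) (I : Set ℝ) (f : ℝ → ℝ) (t : ℝ) : EReal :=
  lowerMean M I f t

/-- The functions `f` whose restriction to `[0, t)` is integrable, takes its values in an interval
whose closure lies in the interior of `I`, and has essential supremum and infimum equal to its
supremum and infimum. -/
def deepClass (I : Set ℝ) (t : ℝ) : Set (ℝ → ℝ) :=
  {f | IntegrableOn f (Ico 0 t) ∧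
    (∃ S : Set ℝ, S.OrdConnected ∧ closure S ⊆ interior I ∧ ∀ x ∈ Ico 0 t, f x ∈ S) ∧
    essSup (fun x => (f x : EReal)) (volume.restrict (Ico 0 t)) = ⨆ x ∈ Ico 0 t, (f x : EReal) ∧
    essInf (fun x => (f x : EReal)) (volume.restrict (Ico 0 t)) = ⨅ x ∈ Ico 0 t, (f x : EReal)}

/-- The integral Hardy constant of a functional mean on `I`: the smallest `C ∈ [0, ∞]` with
`∫_0^∞ 𝔐 (f|[0, t)) dt ≤ C ∫_0^∞ f(t) dt` for every integrable `f : [0, ∞) → I` all of whose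
restrictions `f|[0, t)`, `t > 0`, belong to the domain of the mean. Here `f ∈ X t` says that
`f|[0, t)` belongs to the domain, and `𝔐 f t` is the mean of `f|[0, t)`. -/
def hardyConst (I : Set ℝ) (X : ℝ → Set (ℝ → ℝ)) (𝔐 : (ℝ → ℝ) → ℝ → EReal) : ℝ≥0∞ :=
  sInf {C | ∀ f : ℝ → ℝ, (∀ t, 0 ≤ t → f t ∈ I) → IntegrableOn f (Ici 0) →
    (∀ t, 0 < t → f ∈ X t) →
    ∫⁻ t in Ioi 0, (𝔐 f t).toENNReal ≤ C * ∫⁻ t in Ioi 0, ENNReal.ofReal (f t)}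

end IntegralHardy

end

/-! For each `s` the concave function `f` lies below its tangent at `1 / (c * s)`. Integrated over
`(0, 1)`, where `∫ f (1 / (c * s)) ds = 0` by the choice of `c`, this bounds the mean of `u` on
`[0, t)` by the linear functional `K⁻¹ * ∫ k s * u (t * s) ds` over `(0, 1)`, in which `k s` is the
slope of the tangent and `K = ∫ k s / (c * s) ds`. By Fubini and dilation, the Hardy constant of
this functional is exactly `c`.

Conversely, suppose `∫ f (1 / t) dt > 0` over some interval `(η, y)` with `η ∈ (0, 1]`. For every
`p > 1`, the mean of the test function `max s 1 ^ (-p)` on `[0, t)` is then at least `y * t ^ (-p)`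
for all large `t`, and comparing the integrals as `p → 1` shows that the Hardy constant is at least
`y`. Such `y` exist up to `c`, or up to infinity if `∫ f (1 / t) dt` diverges over `(0, 1)`. -/

noncomputable section

open Filter Topology

namespace IntegralHardy

section Deviation

variable {I : Set ℝ} {E : ℝ → ℝ → ℝ}

lemma IsDeviation.sum_mul_zero_mem_Icc (hE : IsDeviation I E) {n : ℕ} {x w : Fin n → ℝ}
    (hx : ∀ l, x l ∈ I) (hw : ∀ l, 0 ≤ w l) {i j : Fin n} (hi : ∀ l, x i ≤ x l)
    (hj : ∀ l, x l ≤ x j) :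
    0 ∈ Icc (∑ l, w l * E (x l) (x j)) (∑ l, w l * E (x l) (x i)) := by
  have hanti : ∀ l, AntitoneOn (E (x l)) I := fun l => (hE.2 _ (hx l)).2.antitoneOn
  refine ⟨Finset.sum_nonpos fun l _ => mul_nonpos_of_nonneg_of_nonpos (hw l) ?_,
    Finset.sum_nonneg fun l _ => mul_nonneg (hw l) ?_⟩
  · exact (hanti l (hx l) (hx j) (hj l)).trans_eq (hE.1 _ (hx l))
  · exact (hE.1 _ (hx l)).symm.trans_le (hanti l (hx i) (hx l) (hi l))

lemma IsDeviation.deviationMean_spec (hE : IsDeviation I E) (hI : I.OrdConnected) {n : ℕ}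
    [Nonempty (Fin n)] {x w : Fin n → ℝ} (hx : ∀ l, x l ∈ I) (hw : ∀ l, 0 ≤ w l) :
    deviationMean I E n x w ∈ I ∧ ∑ l, w l * E (x l) (deviationMean I E n x w) = 0 := by
  obtain ⟨i, hi⟩ := Finite.exists_min x
  obtain ⟨j, hj⟩ := Finite.exists_max x
  have hcont : ContinuousOn (fun y => ∑ l, w l * E (x l) y) I :=
    continuousOn_finsetSum _ fun l _ => continuousOn_const.mul (hE.2 _ (hx l)).1
  obtain ⟨y, hy, hy0⟩ := hI.isPreconnected.intermediate_value (hx j) (hx i) hcont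
    (hE.sum_mul_zero_mem_Icc hx hw hi hj)
  exact Classical.epsilon_spec (p := fun y => y ∈ I ∧ ∑ l, w l * E (x l) y = 0) ⟨y, hy, hy0⟩

end Deviation

namespace SimpleFn

variable {I : Set ℝ} {a b : ℝ}

lemma Ico_eq_iUnion (g : SimpleFn I a b) :
    Ico a b = ⋃ i : Fin g.n, Ico (g.pt i.castSucc) (g.pt i.succ) := by
  have Ico_pt_subset : ∀ k : Fin (g.n + 1), Ico a (g.pt k) ⊆
      ⋃ i : Fin g.n, Ico (g.pt i.castSucc) (g.pt i.succ) := by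
    intro k
    induction k using Fin.induction with
    | zero => simp [g.pt_zero]
    | succ i ih =>
      intro x hx
      by_cases h : x < g.pt i.castSucc
      · exact ih ⟨hx.1, h⟩
      · exact mem_iUnion.2 ⟨i, not_lt.1 h, hx.2⟩
  refine Subset.antisymm (by simpa [g.pt_last] using Ico_pt_subset (Fin.last _)) ?_
  refine iUnion_subset fun i => Ico_subset_Ico ?_ ?_
  · exact g.pt_zero.symm.trans_le (g.pt_strictMono.monotone (Fin.zero_le _))
  · exact (g.pt_strictMono.monotone (Fin.le_last _)).trans_eq g.pt_last

lemma cell_subset (g : SimpleFn I a b) (i : Fin g.n) :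
    Ico (g.pt i.castSucc) (g.pt i.succ) ⊆ Ico a b := by
  rw [g.Ico_eq_iUnion]
  exact subset_iUnion (fun i : Fin g.n => Ico (g.pt i.castSucc) (g.pt i.succ)) i

lemma pairwise_disjoint_cell (g : SimpleFn I a b) :
    Pairwise (Function.onFun Disjoint fun i : Fin g.n => Ico (g.pt i.castSucc) (g.pt i.succ)) := by
  refine (pairwise_disjoint_on _).2 fun i j hij => ?_
  refine Ico_disjoint_Ico.2 ((min_le_left _ _).trans (le_trans ?_ (le_max_right _ _)))
  exact g.pt_strictMono.monotone (Fin.succ_le_castSucc_iff.2 hij)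

lemma exists_mem_cell (g : SimpleFn I a b) {x : ℝ} (hx : x ∈ Ico a b) :
    ∃ i : Fin g.n, x ∈ Ico (g.pt i.castSucc) (g.pt i.succ) :=
  mem_iUnion.1 (g.Ico_eq_iUnion ▸ hx)

lemma toFun_mem (g : SimpleFn I a b) {x : ℝ} (hx : x ∈ Ico a b) : g.toFun x ∈ I := by
  obtain ⟨i, hi⟩ := g.exists_mem_cell hx
  exact g.toFun_eq i x hi ▸ g.val_mem i

lemma pt_lt_pt (g : SimpleFn I a b) (i : Fin g.n) : g.pt i.castSucc < g.pt i.succ :=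
  g.pt_strictMono Fin.castSucc_lt_succ

lemma nonempty_cells (g : SimpleFn I a b) (hab : a < b) : Nonempty (Fin g.n) :=
  ⟨(g.exists_mem_cell (left_mem_Ico.2 hab)).choose⟩

lemma integrableOn_comp_cell (g : SimpleFn I a b) (φ : ℝ → ℝ) (i : Fin g.n) :
    IntegrableOn (fun x => φ (g.toFun x)) (Ico (g.pt i.castSucc) (g.pt i.succ)) :=
  (integrableOn_const (C := φ (g.val i)) (by simp)).congr_fun
    (fun x hx => by rw [g.toFun_eq i x hx]) measurableSet_Ico

lemma integrableOn_comp (g : SimpleFn I a b) (φ : ℝ → ℝ) :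
    IntegrableOn (fun x => φ (g.toFun x)) (Ioo a b) := by
  refine IntegrableOn.mono_set ?_ Ioo_subset_Ico_self
  rw [g.Ico_eq_iUnion]
  exact integrableOn_finite_iUnion.2 (g.integrableOn_comp_cell φ)

lemma integral_comp (g : SimpleFn I a b) (φ : ℝ → ℝ) :
    ∫ x in Ioo a b, φ (g.toFun x) = ∑ i, (g.pt i.succ - g.pt i.castSucc) * φ (g.val i) := by
  rw [← integral_Ico_eq_integral_Ioo, g.Ico_eq_iUnion, integral_iUnion_fintype
    (fun _ => measurableSet_Ico) g.pairwise_disjoint_cell (g.integrableOn_comp_cell φ)]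
  refine Finset.sum_congr rfl fun i _ => ?_
  rw [setIntegral_congr_fun measurableSet_Ico (g := fun _ => φ (g.val i)) fun x hx => by
    simp only [g.toFun_eq i x hx]]
  simp [(g.pt_lt_pt i).le]

lemma lintegral_eq_sum_cell (g : SimpleFn I a b) (φ : ℝ → ℝ≥0∞) :
    ∫⁻ x in Ico a b, φ x = ∑ i : Fin g.n, ∫⁻ x in Ico (g.pt i.castSucc) (g.pt i.succ), φ x := by
  rw [g.Ico_eq_iUnion, lintegral_iUnion (fun _ => measurableSet_Ico) g.pairwise_disjoint_cell,
    tsum_fintype]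

variable {E : ℝ → ℝ → ℝ}

lemma mean_spec (hE : IsDeviation I E) (hI : I.OrdConnected) (hab : a < b) (g : SimpleFn I a b) :
    g.mean (deviationMean I E) ∈ I ∧
      ∫ x in Ioo a b, E (g.toFun x) (g.mean (deviationMean I E)) = 0 := by
  have := g.nonempty_cells hab
  have hspec := hE.deviationMean_spec hI g.val_mem fun i => (sub_pos.2 (g.pt_lt_pt i)).le
  exact ⟨hspec.1, (g.integral_comp fun v => E v _).trans hspec.2⟩

lemma antitoneOn_integral_deviation (hE : IsDeviation I E) (g : SimpleFn I a b) :
    AntitoneOn (fun y => ∫ x in Ioo a b, E (g.toFun x) y) I := fun y hy z hz hyz =>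
  setIntegral_mono_on (g.integrableOn_comp fun v => E v z) (g.integrableOn_comp fun v => E v y)
    measurableSet_Ioo fun _ hx =>
      (hE.2 _ (g.toFun_mem (Ioo_subset_Ico_self hx))).2.antitoneOn hy hz hyz

lemma le_mean (hE : IsDeviation I E) (hI : I.OrdConnected) (hab : a < b) (g : SimpleFn I a b)
    {y : ℝ} (hy : y ∈ I) (hpos : 0 < ∫ x in Ioo a b, E (g.toFun x) y) :
    y ≤ g.mean (deviationMean I E) := by
  obtain ⟨hmem, hzero⟩ := g.mean_spec hE hI hab
  by_contra! hlt
  exact (hpos.trans_le (g.antitoneOn_integral_deviation hE hmem hy hlt.le)).ne' hzero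

lemma mean_le (hE : IsDeviation I E) (hI : I.OrdConnected) (hab : a < b) (g : SimpleFn I a b)
    {y : ℝ} (hy : y ∈ I) (hneg : ∫ x in Ioo a b, E (g.toFun x) y < 0) :
    g.mean (deviationMean I E) ≤ y := by
  obtain ⟨hmem, hzero⟩ := g.mean_spec hE hI hab
  by_contra! hlt
  exact ((g.antitoneOn_integral_deviation hE hy hmem hlt.le).trans_lt hneg).ne hzero

end SimpleFn

section Concave

variable {f : ℝ → ℝ} {S : Set ℝ} {p x : ℝ}

/-- The right derivative of `f` at `p`, a canonical supergradient of a concave function. -/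
def rightDeriv (f : ℝ → ℝ) (p : ℝ) : ℝ := derivWithin f (Ioi p) p

lemma measurable_rightDeriv (f : ℝ → ℝ) : Measurable (rightDeriv f) :=
  measurable_derivWithin_Ioi f

lemma le_add_rightDeriv_mul (hf : ConcaveOn ℝ S f) (hp : p ∈ interior S) (hx : x ∈ S) :
    f x ≤ f p + rightDeriv f p * (x - p) := by
  have hright : rightDeriv f p = -derivWithin (-f) (Ioi p) p := by
    rw [rightDeriv, derivWithin.neg, neg_neg]
  rw [hright]
  rcases lt_trichotomy p x with h | rfl | h
  · have hslope := hf.neg.rightDeriv_le_slope_of_mem_interior hp hx h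
    rw [slope_def_field, le_div_iff₀ (sub_pos.2 h)] at hslope
    simp only [Pi.neg_apply] at hslope
    linarith
  · simp
  · have hslope := (hf.neg.slope_le_leftDeriv_of_mem_interior hx hp h).trans
      (hf.neg.leftDeriv_le_rightDeriv_of_mem_interior hp)
    rw [slope_def_field, div_le_iff₀ (sub_pos.2 h)] at hslope
    simp only [Pi.neg_apply] at hslope
    linarith

lemma antitoneOn_rightDeriv (hf : ConcaveOn ℝ S f) : AntitoneOn (rightDeriv f) (interior S) := by
  intro p hp x hx hpx
  rcases hpx.eq_or_lt with rfl | hlt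
  · exact le_rfl
  · have h₁ := le_add_rightDeriv_mul hf hp (interior_subset hx)
    have h₂ := le_add_rightDeriv_mul hf hx (interior_subset hp)
    exact le_of_mul_le_mul_right (by linarith) (sub_pos.2 hlt)

lemma rightDeriv_pos (hmono : StrictMonoOn f S) (hf : ConcaveOn ℝ S f) (hp : p ∈ interior S) :
    0 < rightDeriv f p := by
  have hS : S ∈ 𝓝[>] p := mem_nhdsWithin_of_mem_nhds (mem_interior_iff_mem_nhds.1 hp)
  obtain ⟨x, hxS, hpx⟩ := Filter.nonempty_of_mem (inter_mem hS (self_mem_nhdsWithin (s := Ioi p)))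
  have htangent := le_add_rightDeriv_mul hf hp hxS
  have hlt := hmono (interior_subset hp) hxS hpx
  exact pos_of_mul_pos_left (by linarith : 0 < rightDeriv f p * (x - p)) (sub_pos.2 hpx).le

lemma abs_sub_le_rightDeriv_mul (hmono : StrictMonoOn f S) (hf : ConcaveOn ℝ S f) {x y : ℝ}
    (hp : p ∈ interior S) (hx : x ∈ interior S) (hy : y ∈ interior S) (hpx : p ≤ x)
    (hpy : p ≤ y) : |f x - f y| ≤ rightDeriv f p * |x - y| := by
  wlog hxy : y ≤ x generalizing x y
  · rw [abs_sub_comm, abs_sub_comm x]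
    exact this hy hx hpy hpx (le_of_not_ge hxy)
  rw [abs_of_nonneg (sub_nonneg.2 hxy), abs_of_nonneg
    (sub_nonneg.2 (hmono.monotoneOn (interior_subset hy) (interior_subset hx) hxy))]
  calc f x - f y ≤ rightDeriv f y * (x - y) := by
        linarith [le_add_rightDeriv_mul hf hy (interior_subset hx)]
    _ ≤ rightDeriv f p * (x - y) :=
        mul_le_mul_of_nonneg_right (antitoneOn_rightDeriv hf hp hy hpy) (sub_nonneg.2 hxy)

end Concave

section Integral

variable {α : Type*} {_ : MeasurableSpace α} {μ : Measure α}

lemma setIntegral_lt_setIntegral {u v : α → ℝ} {s : Set α} (hs : MeasurableSet s) (hμs : μ s ≠ 0)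
    (hu : IntegrableOn u s μ) (hv : IntegrableOn v s μ) (hlt : ∀ x ∈ s, u x < v x) :
    ∫ x in s, u x ∂μ < ∫ x in s, v x ∂μ := by
  rw [← sub_pos, ← integral_sub hv hu]
  refine (setIntegral_pos_iff_support_of_nonneg_ae ?_ (hv.sub hu)).2 ?_
  · exact (ae_restrict_iff' hs).2 (ae_of_all _ fun x hx => (sub_pos.2 (hlt x hx)).le)
  · rw [inter_eq_self_of_subset_right]
    · exact pos_iff_ne_zero.2 hμs
    · exact fun x hx => (sub_pos.2 (hlt x hx)).ne'

lemma setIntegral_pos {v : α → ℝ} {s : Set α} (hs : MeasurableSet s) (hμs : μ s ≠ 0)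
    (hv : IntegrableOn v s μ) (hpos : ∀ x ∈ s, 0 < v x) : 0 < ∫ x in s, v x ∂μ := by
  simpa using setIntegral_lt_setIntegral (u := 0) hs hμs integrableOn_zero hv hpos

lemma ofReal_setIntegral_mul {u v : α → ℝ} {s : Set α} (hs : MeasurableSet s)
    (hu : ∀ x ∈ s, 0 ≤ u x) (hv : ∀ x ∈ s, 0 ≤ v x)
    (hint : IntegrableOn (fun x => u x * v x) s μ) :
    ENNReal.ofReal (∫ x in s, u x * v x ∂μ) =
      ∫⁻ x in s, ENNReal.ofReal (u x) * ENNReal.ofReal (v x) ∂μ := by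
  rw [ofReal_integral_eq_lintegral_ofReal hint]
  · exact setLIntegral_congr_fun hs fun x hx => ENNReal.ofReal_mul (hu x hx)
  · filter_upwards [ae_restrict_mem hs] with x hx
    exact mul_nonneg (hu x hx) (hv x hx)

lemma integrable_comp_of_concaveOn [IsFiniteMeasure μ] {f : ℝ → ℝ}
    (hmono : StrictMonoOn f (Ioi 0)) (hconc : ConcaveOn ℝ (Ioi 0) f) {u : α → ℝ}
    (hu : Integrable u μ) {b : ℝ} (hb : 0 < b) (hbu : ∀ᵐ x ∂μ, b ≤ u x) :
    Integrable (fun x => f (u x)) μ := by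
  have hcont : Continuous fun v => f (max b v) :=
    (hconc.continuousOn isOpen_Ioi).comp_continuous (by fun_prop) fun v => lt_max_of_lt_left hb
  have hmeas : AEStronglyMeasurable (fun x => f (u x)) μ := by
    refine (hcont.comp_aestronglyMeasurable hu.aestronglyMeasurable).congr ?_
    filter_upwards [hbu] with x hx
    rw [max_eq_right hx]
  have hbound : Integrable (fun x => |f b| + rightDeriv f b * |u x - b|) μ :=
    (integrable_const _).add ((hu.sub (integrable_const b)).abs.const_mul _)
  refine hbound.mono' hmeas ?_
  filter_upwards [hbu] with x hx
  have hlip := abs_sub_le_rightDeriv_mul hmono hconc (by simpa using hb)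
    (by simpa using hb.trans_le hx) (by simpa using hb) hx le_rfl
  calc ‖f (u x)‖ = |f b + (f (u x) - f b)| := by rw [add_sub_cancel, Real.norm_eq_abs]
    _ ≤ |f b| + rightDeriv f b * |u x - b| := (abs_add_le _ _).trans (by gcongr)

end Integral

section Vicinity

variable {I : Set ℝ} {h : ℝ → ℝ} {ε : ℝ}

lemma valueRange_subset {K : Set ℝ} (hK : Convex ℝ K) (hKc : IsClosed K)
    (hh : ∀ x ∈ Ico (0 : ℝ) 1, h x ∈ K) : valueRange h ⊆ K :=
  closure_minimal (convexHull_min (image_subset_iff.2 hh) hK) hKc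

lemma Icc_subset_valueRange (h : ℝ → ℝ) {x y : ℝ} (hx : x ∈ Ico (0 : ℝ) 1)
    (hy : y ∈ Ico (0 : ℝ) 1) : Icc (h x) (h y) ⊆ valueRange h :=
  ((convex_convexHull ℝ _).ordConnected.out (subset_convexHull ℝ _ (mem_image_of_mem h hx))
    (subset_convexHull ℝ _ (mem_image_of_mem h hy))).trans subset_closure

lemma vicinity_mono (I : Set ℝ) (h : ℝ → ℝ) : Monotone (vicinity I h) := fun _ _ hεδ _ hg =>
  ⟨hg.1.trans_le (ENNReal.ofReal_le_ofReal hεδ), hg.2.trans_le (ENNReal.ofReal_le_ofReal hεδ)⟩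

lemma pos_of_mem_vicinity {g : SimpleFn I 0 1} (hg : g ∈ vicinity I h ε) : 0 < ε :=
  ENNReal.ofReal_pos.1 (pos_of_gt hg.2)

lemma integral_abs_sub_le_of_mem_vicinity (hh : IntegrableOn h (Ioo 0 1)) {g : SimpleFn I 0 1}
    (hg : g ∈ vicinity I h ε) : ∫ x in Ioo 0 1, |h x - g.toFun x| ≤ ε := by
  have hd : IntegrableOn (fun x => h x - g.toFun x) (Ioo 0 1) := hh.sub (g.integrableOn_comp id)
  rw [← ENNReal.ofReal_le_ofReal_iff (pos_of_mem_vicinity hg).le,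
    ofReal_integral_eq_lintegral_ofReal hd.abs (ae_of_all _ fun _ => abs_nonneg _)]
  exact (lintegral_mono_set Ioo_subset_Ico_self).trans hg.2.le

lemma abs_integral_sub_le_of_mem_vicinity (hh : IntegrableOn h (Ioo 0 1)) {G H : ℝ → ℝ}
    (hG : IntegrableOn G (Ioo 0 1)) (hH : IntegrableOn H (Ioo 0 1)) {g : SimpleFn I 0 1}
    (hg : g ∈ vicinity I h ε) {L : ℝ} (hL : 0 ≤ L)
    (hGH : ∀ x ∈ Ioo (0 : ℝ) 1, |G x - H x| ≤ L * |h x - g.toFun x|) :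
    |(∫ x in Ioo 0 1, G x) - ∫ x in Ioo 0 1, H x| ≤ L * ε := by
  rw [← integral_sub hG hH]
  calc |∫ x in Ioo 0 1, G x - H x| ≤ ∫ x in Ioo 0 1, |G x - H x| := abs_integral_le_integral_abs
    _ ≤ ∫ x in Ioo 0 1, L * |h x - g.toFun x| :=
        setIntegral_mono_on (hG.sub hH).abs ((hh.sub (g.integrableOn_comp id)).abs.const_mul L)
          measurableSet_Ioo hGH
    _ ≤ L * ε := by
        rw [integral_const_mul]
        exact mul_le_mul_of_nonneg_left (integral_abs_sub_le_of_mem_vicinity hh hg) hL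

lemma exists_sub_lt_of_mem_vicinity {a : ℝ} (ha : ∀ x ∈ Ico (0 : ℝ) 1, a ≤ h x)
    {g : SimpleFn I 0 1} (hg : g ∈ vicinity I h ε) : ∃ y ∈ Ico (0 : ℝ) 1, a - ε < g.toFun y := by
  by_contra! hle
  refine hg.2.not_ge ?_
  calc ENNReal.ofReal ε = ∫⁻ _ in Ico (0 : ℝ) 1, ENNReal.ofReal ε := by simp
    _ ≤ ∫⁻ y in Ico 0 1, ENNReal.ofReal |h y - g.toFun y| :=
        setLIntegral_mono' measurableSet_Ico fun y hy => ENNReal.ofReal_le_ofReal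
          ((by linarith [ha y hy, hle y hy] : ε ≤ h y - g.toFun y).trans (le_abs_self _))

-- Some value of `g` exceeds `a - ε`, so a value below `a - 2 * ε` would push the value range of
-- `g` outside that of `h` by more than `ε`.
lemma sub_two_mul_le_of_mem_vicinity {a : ℝ} (ha : ∀ x ∈ Ico (0 : ℝ) 1, a ≤ h x)
    {g : SimpleFn I 0 1} (hg : g ∈ vicinity I h ε) {x : ℝ} (hx : x ∈ Ico (0 : ℝ) 1) :
    a - 2 * ε ≤ g.toFun x := by
  by_contra! hlt
  have hε := pos_of_mem_vicinity hg
  obtain ⟨y, hy, hgy⟩ := exists_sub_lt_of_mem_vicinity ha hg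
  refine hg.1.not_ge ?_
  calc ENNReal.ofReal ε = volume (Ico (a - 2 * ε) (a - ε)) := by
        rw [Real.volume_Ico]
        congr 1
        ring
    _ ≤ volume (valueRange g.toFun \ valueRange h) := measure_mono fun z hz => by
        have hzg : z ∈ Icc (g.toFun x) (g.toFun y) := ⟨hlt.le.trans hz.1, (hz.2.trans hgy).le⟩
        refine ⟨Icc_subset_valueRange _ hx hy hzg, fun hzh => ?_⟩
        have haz : a ≤ z := valueRange_subset (convex_Ici a) isClosed_Ici ha hzh
        linarith [hz.2]

/-- The simple function with the cells of `g` and the values `v`. -/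
def SimpleFn.withValues {J : Set ℝ} {a b : ℝ} (g : SimpleFn J a b) (v : Fin g.n → ℝ)
    (hv : ∀ i, v i ∈ I) : SimpleFn I a b where
  n := g.n
  pt := g.pt
  pt_strictMono := g.pt_strictMono
  pt_zero := g.pt_zero
  pt_last := g.pt_last
  val := v
  val_mem := hv
  toFun x := ∑ i, (Ico (g.pt i.castSucc) (g.pt i.succ)).indicator (fun _ => v i) x
  toFun_eq i x hx := by
    rw [Finset.sum_eq_single i (fun j _ hj => indicator_of_notMem
      (fun hxj => (g.pairwise_disjoint_cell hj).le_bot ⟨hxj, hx⟩) _) (by simp), indicator_of_mem hx]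

/-- The simple function on `[0, 1)` that takes the value of `φ` at the left end point of each of
the `n + 1` cells of equal length. -/
def SimpleFn.equipartition (φ : ℝ → ℝ) (n : ℕ) : SimpleFn univ 0 1 where
  n := n + 1
  pt i := (i : ℕ) / (n + 1)
  pt_strictMono i j hij :=
    div_lt_div_of_pos_right (Nat.cast_lt.2 (Fin.lt_def.1 hij)) (by positivity)
  pt_zero := by simp
  pt_last := by simp [Nat.cast_add_one_ne_zero n]
  val i := φ ((i : ℕ) / (n + 1))
  val_mem _ := mem_univ _
  toFun x := φ (⌊(n + 1) * x⌋₊ / (n + 1))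
  toFun_eq i x hx := by
    have hn : (0 : ℝ) < n + 1 := by positivity
    have hfloor : ⌊(n + 1) * x⌋₊ = (i : ℕ) := by
      simp only [Fin.val_castSucc, Fin.val_succ, Nat.cast_add_one, mem_Ico, div_le_iff₀' hn,
        lt_div_iff₀' hn] at hx
      exact (Nat.floor_eq_iff ((Nat.cast_nonneg _).trans hx.1)).2 hx
    rw [hfloor]

lemma SimpleFn.exists_abs_sub_equipartition_lt {φ : ℝ → ℝ} (hφ : ContinuousOn φ (Icc 0 1))
    (hε : 0 < ε) :
    ∃ n, ∀ x ∈ Ico (0 : ℝ) 1, |φ x - (SimpleFn.equipartition φ n).toFun x| < ε := by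
  obtain ⟨δ, hδ, hδφ⟩ := Metric.uniformContinuousOn_iff.1
    (isCompact_Icc.uniformContinuousOn_of_continuous hφ) ε hε
  obtain ⟨n, hn⟩ := exists_nat_one_div_lt hδ
  have hN : (0 : ℝ) < n + 1 := by positivity
  refine ⟨n, fun x hx => ?_⟩
  have hfloor_le : (⌊(n + 1) * x⌋₊ : ℝ) / (n + 1) ≤ x := by
    rw [div_le_iff₀' hN]
    exact Nat.floor_le (mul_nonneg hN.le hx.1)
  have hlt_floor : x < (⌊(n + 1) * x⌋₊ : ℝ) / (n + 1) + 1 / (n + 1) := by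
    rw [← add_div, lt_div_iff₀' hN]
    exact Nat.lt_floor_add_one _
  refine hδφ x (Ico_subset_Icc_self hx) _ ⟨by positivity, hfloor_le.trans hx.2.le⟩ ?_
  rw [Real.dist_eq, abs_of_nonneg (sub_nonneg.2 hfloor_le)]
  linarith

lemma SimpleFn.exists_lintegral_abs_sub_le (hh : IntegrableOn h (Ico 0 1)) (hε : 0 < ε) :
    ∃ g : SimpleFn univ 0 1,
      ∫⁻ x in Ico 0 1, ENNReal.ofReal |h x - g.toFun x| ≤ ENNReal.ofReal ε := by
  have hhalf : 0 < ε / 2 := half_pos hε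
  obtain ⟨φ, -, hφ, hφc, -⟩ := Integrable.exists_hasCompactSupport_lintegral_sub_le hh
    (ENNReal.ofReal_pos.2 hhalf).ne'
  obtain ⟨n, hn⟩ := SimpleFn.exists_abs_sub_equipartition_lt hφc.continuousOn hhalf
  refine ⟨SimpleFn.equipartition φ n, ?_⟩
  calc ∫⁻ x in Ico 0 1, ENNReal.ofReal |h x - (SimpleFn.equipartition φ n).toFun x|
      ≤ ∫⁻ x in Ico 0 1, (ENNReal.ofReal |h x - φ x| + ENNReal.ofReal (ε / 2)) := by
        refine setLIntegral_mono' measurableSet_Ico fun x hx => ?_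
        rw [← ENNReal.ofReal_add (abs_nonneg _) hhalf.le]
        exact ENNReal.ofReal_le_ofReal
          ((abs_sub_le _ (φ x) _).trans (add_le_add_right (hn x hx).le _))
    _ ≤ ENNReal.ofReal (ε / 2) + ENNReal.ofReal (ε / 2) := by
        rw [lintegral_add_right _ measurable_const, setLIntegral_const]
        gcongr
        · simpa only [Real.enorm_eq_ofReal_abs] using hφ
        · simp
    _ = ENNReal.ofReal ε := by rw [← ENNReal.ofReal_add hhalf.le hhalf.le, add_halves]

-- First moment method: some `ξ ∈ s` has `|u ξ - c|` at most the average of `|u - c|` over `s`.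
lemma exists_mem_lintegral_abs_sub_le {α : Type*} {_ : MeasurableSpace α} {μ : Measure α}
    {u : α → ℝ} {s : Set α} (h0 : μ s ≠ 0) (hfin : μ s ≠ ⊤) (hu : AEMeasurable u (μ.restrict s))
    (c : ℝ) : ∃ ξ ∈ s, ∫⁻ x in s, ENNReal.ofReal |u x - u ξ| ∂μ ≤
      2 * ∫⁻ x in s, ENNReal.ofReal |u x - c| ∂μ := by
  have hm : AEMeasurable (fun x => ENNReal.ofReal |u x - c|) (μ.restrict s) :=
    (continuous_abs.measurable.comp_aemeasurable (hu.sub_const c)).ennreal_ofReal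
  obtain ⟨ξ, hξ, hle⟩ := exists_le_setLAverage h0 hfin hm
  refine ⟨ξ, hξ, ?_⟩
  rw [setLAverage_eq, ENNReal.le_div_iff_mul_le (Or.inl h0) (Or.inl hfin)] at hle
  calc ∫⁻ x in s, ENNReal.ofReal |u x - u ξ| ∂μ
      ≤ ∫⁻ x in s, (ENNReal.ofReal |u x - c| + ENNReal.ofReal |u ξ - c|) ∂μ := by
        refine lintegral_mono fun x => ?_
        rw [← ENNReal.ofReal_add (abs_nonneg _) (abs_nonneg _), abs_sub_comm (u ξ) c]
        exact ENNReal.ofReal_le_ofReal (abs_sub_le _ _ _)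
    _ = (∫⁻ x in s, ENNReal.ofReal |u x - c| ∂μ) + ENNReal.ofReal |u ξ - c| * μ s := by
        rw [lintegral_add_right _ measurable_const, setLIntegral_const]
    _ ≤ 2 * ∫⁻ x in s, ENNReal.ofReal |u x - c| ∂μ := by
        rw [two_mul]
        gcongr

lemma SimpleFn.exists_values_mem_image {J : Set ℝ} {a b : ℝ} (g : SimpleFn J a b)
    (hh : AEMeasurable h (volume.restrict (Ico a b))) (hI : ∀ x ∈ Ico a b, h x ∈ I) :
    ∃ g' : SimpleFn I a b, (∀ x ∈ Ico a b, g'.toFun x ∈ h '' Ico a b) ∧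
      ∫⁻ x in Ico a b, ENNReal.ofReal |h x - g'.toFun x| ≤
        2 * ∫⁻ x in Ico a b, ENNReal.ofReal |h x - g.toFun x| := by
  have hcell : ∀ i : Fin g.n, ∃ ξ ∈ Ico (g.pt i.castSucc) (g.pt i.succ),
      ∫⁻ x in Ico (g.pt i.castSucc) (g.pt i.succ), ENNReal.ofReal |h x - h ξ| ≤
        2 * ∫⁻ x in Ico (g.pt i.castSucc) (g.pt i.succ), ENNReal.ofReal |h x - g.val i| := fun i =>
    exists_mem_lintegral_abs_sub_le (by simpa using g.pt_lt_pt i) (by simp)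
      (hh.mono_set (g.cell_subset i)) (g.val i)
  choose ξ hξ hle using hcell
  have hξI : ∀ i, ξ i ∈ Ico a b := fun i => g.cell_subset i (hξ i)
  let g' : SimpleFn I a b := g.withValues (fun i => h (ξ i)) fun i => hI _ (hξI i)
  refine ⟨g', fun x hx => ?_, ?_⟩
  · obtain ⟨i, hi⟩ := g'.exists_mem_cell hx
    exact g'.toFun_eq i x hi ▸ mem_image_of_mem h (hξI i)
  · rw [g.lintegral_eq_sum_cell, g.lintegral_eq_sum_cell, Finset.mul_sum]
    refine Finset.sum_le_sum fun i _ => ?_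
    calc ∫⁻ x in Ico (g.pt i.castSucc) (g.pt i.succ), ENNReal.ofReal |h x - g'.toFun x|
        = ∫⁻ x in Ico (g.pt i.castSucc) (g.pt i.succ), ENNReal.ofReal |h x - h (ξ i)| :=
          setLIntegral_congr_fun measurableSet_Ico fun x hx => by
            simp only [g'.toFun_eq i x hx]
            rfl
      _ ≤ _ := hle i
      _ = _ := congrArg (2 * ·) (setLIntegral_congr_fun measurableSet_Ico fun x hx => by
          simp only [g.toFun_eq i x hx])

lemma vicinity_nonempty (hh : IntegrableOn h (Ico 0 1)) (hI : ∀ x ∈ Ico (0 : ℝ) 1, h x ∈ I)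
    (hε : 0 < ε) : (vicinity I h ε).Nonempty := by
  obtain ⟨g₀, hg₀⟩ := SimpleFn.exists_lintegral_abs_sub_le hh (by positivity : 0 < ε / 4)
  obtain ⟨g, hgh, hg⟩ := g₀.exists_values_mem_image hh.aemeasurable hI
  refine ⟨g, ?_, ?_⟩
  · have hrange : valueRange g.toFun ⊆ valueRange h :=
      closure_mono (convexHull_mono (image_subset_iff.2 hgh))
    rw [sdiff_eq_empty.2 hrange, measure_empty]
    exact ENNReal.ofReal_pos.2 hε
  · calc ∫⁻ x in Ico 0 1, ENNReal.ofReal |h x - g.toFun x|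
        ≤ 2 * ENNReal.ofReal (ε / 4) := hg.trans (by gcongr)
      _ = ENNReal.ofReal (ε / 2) := by
          rw [← ENNReal.ofReal_ofNat 2, ← ENNReal.ofReal_mul zero_le_two]
          congr 1
          ring
      _ < ENNReal.ofReal ε := (ENNReal.ofReal_lt_ofReal_iff hε).2 (half_lt_self hε)

lemma lowerMean_le_upperMean (M : WeightedMean) {t : ℝ}
    (hne : ∀ ε, 0 < ε → (vicinity I (rescale h t) ε).Nonempty) :
    lowerMean M I h t ≤ upperMean M I h t := by
  refine iSup₂_le fun ε hε => le_iInf₂ fun δ hδ => ?_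
  obtain ⟨g, hg⟩ := hne (min ε δ) (lt_min hε hδ)
  exact (iInf₂_le g (vicinity_mono _ _ (min_le_left _ _) hg)).trans
    (le_iSup₂_of_le g (vicinity_mono _ _ (min_le_right _ _) hg) le_rfl)

end Vicinity

section HomogeneousMean

variable {f h : ℝ → ℝ} {t a y : ℝ}

/-- The weighted mean generated by the homogeneous deviation `(x, y) ↦ f (x / y)` on `(0, ∞)`. -/
abbrev homogeneousMean (f : ℝ → ℝ) : WeightedMean := deviationMean (Ioi 0) fun x y => f (x / y)

lemma isDeviation_div (hmono : StrictMonoOn f (Ioi 0)) (hconc : ConcaveOn ℝ (Ioi 0) f)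
    (hone : f 1 = 0) : IsDeviation (Ioi 0) fun x y => f (x / y) := by
  refine ⟨fun x hx => (congrArg f (div_self (mem_Ioi.1 hx).ne')).trans hone, fun x hx => ⟨?_, ?_⟩⟩
  · exact (hconc.continuousOn isOpen_Ioi).comp
      (continuousOn_const.div continuousOn_id fun y hy => (mem_Ioi.1 hy).ne')
      fun y hy => div_pos (mem_Ioi.1 hx) hy
  · intro y hy z hz hyz
    exact hmono (div_pos (mem_Ioi.1 hx) hz) (div_pos (mem_Ioi.1 hx) hy)
      (div_lt_div_of_pos_left hx hy hyz)

lemma strictAntiOn_integral_comp_div {α : Type*} {_ : MeasurableSpace α} {μ : Measure α}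
    {u : α → ℝ} {s : Set α} (hmono : StrictMonoOn f (Ioi 0)) (hs : MeasurableSet s)
    (hμs : μ s ≠ 0) (hu : ∀ x ∈ s, 0 < u x)
    (hint : ∀ y, 0 < y → IntegrableOn (fun x => f (u x / y)) s μ) :
    StrictAntiOn (fun y => ∫ x in s, f (u x / y) ∂μ) (Ioi 0) := fun y hy z hz hyz =>
  setIntegral_lt_setIntegral hs hμs (hint z hz) (hint y hy) fun x hx =>
    hmono (div_pos (hu x hx) hz) (div_pos (hu x hx) hy) (div_lt_div_of_pos_left (hu x hx) hy hyz)

lemma rescale_mem {K : Set ℝ} (ht : 0 < t) (hh : ∀ x ∈ Ico 0 t, h x ∈ K) :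
    ∀ x ∈ Ico (0 : ℝ) 1, rescale h t x ∈ K := fun _ hx =>
  hh _ ⟨mul_nonneg ht.le hx.1, (mul_lt_iff_lt_one_right ht).2 hx.2⟩

lemma integrableOn_comp_mul_left (ht : 0 < t) (hh : IntegrableOn h (Ioo 0 t)) :
    IntegrableOn (fun x => h (t * x)) (Ioo 0 1) := by
  rw [← intervalIntegrable_iff_integrableOn_Ioo_of_le ht.le] at hh
  rw [← intervalIntegrable_iff_integrableOn_Ioo_of_le zero_le_one]
  simpa only [zero_div, div_self ht.ne'] using hh.comp_mul_left (c := t)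

lemma integrableOn_rescale (ht : 0 < t) (hh : IntegrableOn h (Ico 0 t)) :
    IntegrableOn (rescale h t) (Ioo 0 1) :=
  integrableOn_comp_mul_left ht (hh.mono_set Ioo_subset_Ico_self)

lemma integrableOn_comp_div (hmono : StrictMonoOn f (Ioi 0)) (hconc : ConcaveOn ℝ (Ioi 0) f)
    (hh : IntegrableOn h (Ioo 0 1)) (ha0 : 0 < a) (ha : ∀ x ∈ Ico (0 : ℝ) 1, a ≤ h x)
    (hy : 0 < y) : IntegrableOn (fun x => f (h x / y)) (Ioo 0 1) :=
  integrable_comp_of_concaveOn hmono hconc (hh.div_const y) (div_pos ha0 hy) <|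
    (ae_restrict_iff' measurableSet_Ioo).2 <| ae_of_all _ fun x hx =>
      div_le_div_of_nonneg_right (ha x (Ioo_subset_Ico_self hx)) hy.le

lemma eventually_abs_integral_comp_div_sub_lt (hmono : StrictMonoOn f (Ioi 0))
    (hconc : ConcaveOn ℝ (Ioi 0) f) {I : Set ℝ} (hh : IntegrableOn h (Ioo 0 1)) (ha0 : 0 < a)
    (ha : ∀ x ∈ Ico (0 : ℝ) 1, a ≤ h x) (hy : 0 < y) {δ : ℝ} (hδ : 0 < δ) :
    ∀ᶠ ε in 𝓝[>] 0, ∀ g ∈ vicinity I h ε,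
      |(∫ x in Ioo 0 1, f (g.toFun x / y)) - ∫ x in Ioo 0 1, f (h x / y)| < δ := by
  have hp : 0 < a / 2 / y := by positivity
  set L := rightDeriv f (a / 2 / y) / y
  have hL0 : 0 < L := div_pos (rightDeriv_pos hmono hconc (by simpa using hp)) hy
  filter_upwards [Ioo_mem_nhdsGT (by positivity : 0 < min (a / 4) (δ / L))] with ε hε g hg
  have hεa : ε < a / 4 := hε.2.trans_le (min_le_left _ _)
  have hεL : L * ε < δ := (lt_div_iff₀' hL0).1 (hε.2.trans_le (min_le_right _ _))
  refine (abs_integral_sub_le_of_mem_vicinity hh (g.integrableOn_comp fun v => f (v / y))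
    (integrableOn_comp_div hmono hconc hh ha0 ha hy) hg hL0.le fun x hx => ?_).trans_lt hεL
  have hg_ge := sub_two_mul_le_of_mem_vicinity ha hg (Ioo_subset_Ico_self hx)
  have hpg : a / 2 / y ≤ g.toFun x / y := div_le_div_of_nonneg_right (by linarith) hy.le
  have hph : a / 2 / y ≤ h x / y :=
    div_le_div_of_nonneg_right (by linarith [ha x (Ioo_subset_Ico_self hx)]) hy.le
  have hlip := abs_sub_le_rightDeriv_mul hmono hconc (by simpa using hp)
    (by simpa using hp.trans_le hpg) (by simpa using hp.trans_le hph) hpg hph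
  rwa [← sub_div, abs_div, abs_of_pos hy, abs_sub_comm (g.toFun x), ← mul_comm_div] at hlip

lemma le_lowerMean (hmono : StrictMonoOn f (Ioi 0)) (hconc : ConcaveOn ℝ (Ioi 0) f)
    (hone : f 1 = 0) (ht : 0 < t) (hh : IntegrableOn h (Ico 0 t)) (ha0 : 0 < a)
    (ha : ∀ x ∈ Ico 0 t, a ≤ h x) (hy : 0 < y)
    (hpos : 0 < ∫ x in Ioo 0 1, f (rescale h t x / y)) :
    (y : EReal) ≤ lowerMean (homogeneousMean f) (Ioi 0) h t := by
  obtain ⟨ε, hclose, hε⟩ := ((eventually_abs_integral_comp_div_sub_lt hmono hconc (I := Ioi 0)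
    (integrableOn_rescale ht hh) ha0
    (rescale_mem (K := Ici a) ht ha) hy hpos).and self_mem_nhdsWithin).exists
  refine le_iSup₂_of_le ε hε (le_iInf₂ fun g hg => EReal.coe_le_coe_iff.2 ?_)
  exact g.le_mean (isDeviation_div hmono hconc hone) ordConnected_Ioi one_pos hy
    (by linarith [(abs_lt.1 (hclose g hg)).1])

lemma upperMean_le (hmono : StrictMonoOn f (Ioi 0)) (hconc : ConcaveOn ℝ (Ioi 0) f)
    (hone : f 1 = 0) (ht : 0 < t) (hh : IntegrableOn h (Ico 0 t)) (ha0 : 0 < a)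
    (ha : ∀ x ∈ Ico 0 t, a ≤ h x) (hy : 0 < y)
    (hneg : ∫ x in Ioo 0 1, f (rescale h t x / y) < 0) :
    upperMean (homogeneousMean f) (Ioi 0) h t ≤ y := by
  obtain ⟨ε, hclose, hε⟩ := ((eventually_abs_integral_comp_div_sub_lt hmono hconc (I := Ioi 0)
    (integrableOn_rescale ht hh) ha0
    (rescale_mem (K := Ici a) ht ha) hy (neg_pos.2 hneg)).and self_mem_nhdsWithin).exists
  refine iInf₂_le_of_le ε hε (iSup₂_le fun g hg => EReal.coe_le_coe_iff.2 ?_)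
  exact g.mean_le (isDeviation_div hmono hconc hone) ordConnected_Ioi one_pos hy
    (by linarith [(abs_lt.1 (hclose g hg)).2])

lemma lowerMean_eq_upperMean (hmono : StrictMonoOn f (Ioi 0)) (hconc : ConcaveOn ℝ (Ioi 0) f)
    (hone : f 1 = 0) (ht : 0 < t) (hh : IntegrableOn h (Ico 0 t)) (ha0 : 0 < a)
    (ha : ∀ x ∈ Ico 0 t, a ≤ h x) :
    lowerMean (homogeneousMean f) (Ioi 0) h t = upperMean (homogeneousMean f) (Ioi 0) h t := by
  have hr := integrableOn_rescale ht hh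
  have har := rescale_mem (K := Ici a) ht ha
  have hint : ∀ y, 0 < y → IntegrableOn (fun x => f (rescale h t x / y)) (Ioo 0 1) := fun y hy =>
    integrableOn_comp_div hmono hconc hr ha0 har hy
  refine le_antisymm (lowerMean_le_upperMean _ fun ε => vicinity_nonempty
    ((integrableOn_Ico_iff_integrableOn_Ioo (by simp)).2 hr) fun x hx => ha0.trans_le (har x hx)) ?_
  have hlower : ((a / 2 : ℝ) : EReal) ≤ lowerMean (homogeneousMean f) (Ioi 0) h t := by
    refine le_lowerMean hmono hconc hone ht hh ha0 ha (half_pos ha0) ?_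
    refine setIntegral_pos measurableSet_Ioo (by simp) (hint _ (half_pos ha0)) fun x hx => ?_
    have hone_lt : 1 < rescale h t x / (a / 2) := by
      rw [one_lt_div (half_pos ha0)]
      exact (half_lt_self ha0).trans_le (har x (Ioo_subset_Ico_self hx))
    exact hone.symm.trans_lt (hmono (mem_Ioi.2 one_pos) (one_pos.trans hone_lt) hone_lt)
  by_contra! hlt
  obtain ⟨r, hlr, hru⟩ := EReal.lt_iff_exists_real_btwn.1 hlt
  obtain ⟨s, hrs, hsu⟩ := EReal.lt_iff_exists_real_btwn.1 hru
  have hr0 : 0 < r := (half_pos ha0).trans (EReal.coe_lt_coe_iff.1 (hlower.trans_lt hlr))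
  have hs0 : 0 < s := hr0.trans (EReal.coe_lt_coe_iff.1 hrs)
  have hr_le : ∫ x in Ioo 0 1, f (rescale h t x / r) ≤ 0 :=
    le_of_not_gt fun hpos => hlr.not_ge (le_lowerMean hmono hconc hone ht hh ha0 ha hr0 hpos)
  have hs_ge : 0 ≤ ∫ x in Ioo 0 1, f (rescale h t x / s) :=
    le_of_not_gt fun hneg => hsu.not_ge (upperMean_le hmono hconc hone ht hh ha0 ha hs0 hneg)
  exact (hr_le.trans hs_ge).not_gt (strictAntiOn_integral_comp_div hmono measurableSet_Ioo (by simp)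
    (fun x hx => ha0.trans_le (har x (Ioo_subset_Ico_self hx))) hint hr0 hs0
    (EReal.coe_lt_coe_iff.1 hrs))

lemma exists_pos_le_of_mem_deepClass (hh : h ∈ deepClass (Ioi 0) t) :
    ∃ a, 0 < a ∧ ∀ x ∈ Ico 0 t, a ≤ h x := by
  obtain ⟨-, ⟨S, -, hS, hmem⟩, -, -⟩ := hh
  rw [interior_Ioi] at hS
  have hzero : (0 : ℝ) ∈ (closure S)ᶜ := fun hzero => lt_irrefl _ (mem_Ioi.1 (hS hzero))
  obtain ⟨a, ha, hball⟩ := Metric.isOpen_iff.1 isClosed_closure.isOpen_compl 0 hzero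
  refine ⟨a, ha, fun x hx => ?_⟩
  have hxS := subset_closure (hmem x hx)
  by_contra! hlt
  refine hball ?_ hxS
  rwa [Metric.mem_ball, Real.dist_eq, sub_zero, abs_of_pos (mem_Ioi.1 (hS hxS))]

end HomogeneousMean

section ReciprocalIntegral

variable {f : ℝ → ℝ} {b c t : ℝ}

lemma comp_one_div_pos (hmono : StrictMonoOn f (Ioi 0)) (hone : f 1 = 0)
    (ht : t ∈ Ioo (0 : ℝ) 1) : 0 < f (1 / t) :=
  hone.symm.trans_lt (hmono (mem_Ioi.2 one_pos) (one_div_pos.2 ht.1) (one_lt_one_div ht.1 ht.2))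

lemma continuousOn_comp_one_div (hconc : ConcaveOn ℝ (Ioi 0) f) :
    ContinuousOn (fun t => f (1 / t)) (Ioi 0) :=
  (hconc.continuousOn isOpen_Ioi).comp
    (continuousOn_const.div continuousOn_id fun _ ht => (mem_Ioi.1 ht).ne')
      fun _ => one_div_pos.2 ∘ mem_Ioi.1

lemma lintegral_comp_one_div_lt_top_iff (hmono : StrictMonoOn f (Ioi 0))
    (hconc : ConcaveOn ℝ (Ioi 0) f) (hone : f 1 = 0) :
    ∫⁻ t in Ioo (0 : ℝ) 1, ENNReal.ofReal (f (1 / t)) < ⊤ ↔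
      IntegrableOn (fun t => f (1 / t)) (Ioo 0 1) := by
  have hmeas := ((continuousOn_comp_one_div hconc).mono
    (Ioo_subset_Ioi_self : Ioo (0 : ℝ) 1 ⊆ Ioi 0)).aestronglyMeasurable (μ := volume)
    measurableSet_Ioo
  rw [lt_top_iff_ne_top, lintegral_ofReal_ne_top_iff_integrable hmeas]
  · rfl
  · exact (ae_restrict_iff' measurableSet_Ioo).2 <| ae_of_all _ fun t ht =>
      (comp_one_div_pos hmono hone ht).le

lemma intervalIntegrable_comp_one_div (hconc : ConcaveOn ℝ (Ioi 0) f)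
    (hint : IntegrableOn (fun t => f (1 / t)) (Ioo 0 1)) (hb : 0 < b) :
    IntervalIntegrable (fun t => f (1 / t)) volume 0 b := by
  rw [← intervalIntegrable_iff_integrableOn_Ioo_of_le zero_le_one] at hint
  refine hint.trans (ContinuousOn.intervalIntegrable ?_)
  exact (continuousOn_comp_one_div hconc).mono fun t ht => (lt_min one_pos hb).trans_le ht.1

lemma integrableOn_comp_one_div_mul (hconc : ConcaveOn ℝ (Ioi 0) f)
    (hint : IntegrableOn (fun t => f (1 / t)) (Ioo 0 1)) (hb : 0 < b) :
    IntegrableOn (fun s => f (1 / (b * s))) (Ioo 0 1) :=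
  integrableOn_comp_mul_left (h := fun t => f (1 / t)) hb <|
    (intervalIntegrable_iff_integrableOn_Ioo_of_le hb.le).1
      (intervalIntegrable_comp_one_div hconc hint hb)

lemma integral_comp_one_div_mul (f : ℝ → ℝ) (hb : b ≠ 0) :
    ∫ s in Ioo 0 1, f (1 / (b * s)) = b⁻¹ * ∫ t in (0 : ℝ)..b, f (1 / t) := by
  rw [← integral_Ioc_eq_integral_Ioo, ← intervalIntegral.integral_of_le zero_le_one,
    intervalIntegral.integral_comp_mul_left (fun t => f (1 / t)) hb]
  simp

lemma strictAntiOn_integral_comp_one_div_mul (hmono : StrictMonoOn f (Ioi 0))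
    (hconc : ConcaveOn ℝ (Ioi 0) f) (hint : IntegrableOn (fun t => f (1 / t)) (Ioo 0 1)) :
    StrictAntiOn (fun b => ∫ s in Ioo 0 1, f (1 / (b * s))) (Ioi 0) := by
  have hrw : ∀ b s : ℝ, 1 / (b * s) = 1 / s / b := fun b s => by rw [div_div, mul_comm]
  simp only [hrw]
  refine strictAntiOn_integral_comp_div hmono measurableSet_Ioo (by simp)
    (fun s hs => one_div_pos.2 hs.1) fun b hb => ?_
  simpa only [hrw] using integrableOn_comp_one_div_mul hconc hint hb

lemma integral_comp_one_div_pos (hmono : StrictMonoOn f (Ioi 0))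
    (hconc : ConcaveOn ℝ (Ioi 0) f) (hone : f 1 = 0)
    (hint : IntegrableOn (fun t => f (1 / t)) (Ioo 0 1)) :
    0 < ∫ t in (0 : ℝ)..1, f (1 / t) :=
  intervalIntegral.intervalIntegral_pos_of_pos_on
    (intervalIntegrable_comp_one_div hconc hint one_pos)
    (fun _ ht => comp_one_div_pos hmono hone ht) one_pos

lemma one_lt_of_integral_comp_one_div_eq_zero (hmono : StrictMonoOn f (Ioi 0))
    (hconc : ConcaveOn ℝ (Ioi 0) f) (hone : f 1 = 0)
    (hint : IntegrableOn (fun t => f (1 / t)) (Ioo 0 1)) (hc : 0 < c)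
    (hzero : ∫ t in (0 : ℝ)..c, f (1 / t) = 0) : 1 < c := by
  by_contra! hle
  refine (integral_comp_one_div_pos hmono hconc hone hint).not_ge ?_
  have havg : ∫ s in Ioo 0 1, f (1 / (1 * s)) ≤ ∫ s in Ioo 0 1, f (1 / (c * s)) :=
    (strictAntiOn_integral_comp_one_div_mul hmono hconc hint).antitoneOn hc (mem_Ioi.2 one_pos) hle
  rwa [integral_comp_one_div_mul f hc.ne', integral_comp_one_div_mul f one_ne_zero, hzero,
    mul_zero, inv_one, one_mul] at havg

lemma integral_comp_one_div_le (hmono : StrictMonoOn f (Ioi 0))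
    (hconc : ConcaveOn ℝ (Ioi 0) f) (hint : IntegrableOn (fun t => f (1 / t)) (Ioo 0 1))
    (hc : 0 < c) (hcb : c ≤ b) :
    ∫ t in (0 : ℝ)..b, f (1 / t) ≤ (∫ t in (0 : ℝ)..c, f (1 / t)) + (b - c) * f (1 / c) := by
  have h0c := intervalIntegrable_comp_one_div hconc hint hc
  have hcb' := h0c.symm.trans (intervalIntegrable_comp_one_div hconc hint (hc.trans_le hcb))
  rw [← intervalIntegral.integral_add_adjacent_intervals h0c hcb']
  gcongr
  calc ∫ t in c..b, f (1 / t) ≤ ∫ _ in c..b, f (1 / c) :=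
        intervalIntegral.integral_mono_on hcb hcb' intervalIntegrable_const fun t ht =>
          hmono.monotoneOn (one_div_pos.2 (hc.trans_le ht.1)) (one_div_pos.2 hc)
            (one_div_le_one_div_of_le hc ht.1)
    _ = (b - c) * f (1 / c) := by rw [intervalIntegral.integral_const, smul_eq_mul]

lemma existsUnique_integral_comp_one_div_eq_zero (hmono : StrictMonoOn f (Ioi 0))
    (hconc : ConcaveOn ℝ (Ioi 0) f) (hone : f 1 = 0)
    (hint : IntegrableOn (fun t => f (1 / t)) (Ioo 0 1)) :
    ∃! c : ℝ, 0 < c ∧ ∫ t in (0 : ℝ)..c, f (1 / t) = 0 := by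
  have hhalf : f (1 / 2) < 0 :=
    (hmono (by simp) (mem_Ioi.2 one_pos) (by norm_num)).trans_eq hone
  obtain ⟨b, hb2, hb⟩ : ∃ b : ℝ, 2 ≤ b ∧ ∫ t in (0 : ℝ)..b, f (1 / t) ≤ 0 := by
    set A := ∫ t in (0 : ℝ)..2, f (1 / t) with hA
    refine ⟨2 + |A| / -f (1 / 2), le_add_of_nonneg_right (by bound), ?_⟩
    refine (integral_comp_one_div_le hmono hconc hint two_pos (by bound)).trans ?_
    rw [← hA, add_sub_cancel_left, div_neg, neg_mul, div_mul_cancel₀ _ hhalf.ne]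
    linarith [le_abs_self A]
  have hcont : ContinuousOn (fun x => ∫ t in (0 : ℝ)..x, f (1 / t)) (Icc 1 b) := by
    have hprim := intervalIntegral.continuousOn_primitive_interval'
      (intervalIntegrable_comp_one_div hconc hint (by linarith : 0 < b)) left_mem_uIcc
    rw [uIcc_of_le (by linarith)] at hprim
    exact hprim.mono (Icc_subset_Icc_left zero_le_one)
  obtain ⟨c, hc, hzero⟩ := intermediate_value_Icc' (by linarith : (1 : ℝ) ≤ b) hcont
    ⟨hb, (integral_comp_one_div_pos hmono hconc hone hint).le⟩
  refine ⟨c, ⟨one_pos.trans_le hc.1, hzero⟩, fun c' hc' => ?_⟩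
  refine (strictAntiOn_integral_comp_one_div_mul hmono hconc hint).injOn hc'.1
    (one_pos.trans_le hc.1) ?_
  simp only [integral_comp_one_div_mul f hc'.1.ne',
    integral_comp_one_div_mul f (one_pos.trans_le hc.1).ne', hc'.2, hzero, mul_zero]

end ReciprocalIntegral

section Dilation

variable {t : ℝ}

lemma map_mul_left_restrict_Ioi (ht : 0 < t) :
    (volume.restrict (Ioi 0)).map (t * ·) = ENNReal.ofReal t⁻¹ • volume.restrict (Ioi 0) := by
  have hpre : (t * ·) ⁻¹' Ioi 0 = Ioi 0 := by simp [Set.preimage_const_mul_Ioi₀ _ ht]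
  rw [← Measure.restrict_smul, ← abs_of_pos (inv_pos.2 ht), ← Real.map_volume_mul_left ht.ne',
    (measurableEmbedding_mulLeft₀ ht.ne').restrict_map, hpre]

lemma lintegral_Ioi_comp_mul_left (φ : ℝ → ℝ≥0∞) (ht : 0 < t) :
    ∫⁻ x in Ioi 0, φ (t * x) = ENNReal.ofReal t⁻¹ * ∫⁻ x in Ioi 0, φ x := by
  rw [← (measurableEmbedding_mulLeft₀ ht.ne').lintegral_map φ, map_mul_left_restrict_Ioi ht,
    lintegral_smul_measure, smul_eq_mul]

lemma ae_restrict_Ioi_comp_mul_left {P : ℝ → Prop} (ht : 0 < t)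
    (h : ∀ᵐ x ∂volume.restrict (Ioi 0), P x) : ∀ᵐ x ∂volume.restrict (Ioi 0), P (t * x) := by
  rw [← (measurableEmbedding_mulLeft₀ ht.ne').ae_map_iff, map_mul_left_restrict_Ioi ht]
  exact Measure.ae_smul_measure h _

lemma lintegral_lintegral_mul_comp_mul {k v : ℝ → ℝ≥0∞} {S : Set ℝ} (hS : MeasurableSet S)
    (hSpos : S ⊆ Ioi 0) (hk : AEMeasurable k (volume.restrict S))
    (hv : AEMeasurable v (volume.restrict (Ioi 0))) :
    ∫⁻ t in Ioi 0, ∫⁻ s in S, k s * v (t * s) =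
      (∫⁻ s in S, k s * ENNReal.ofReal s⁻¹) * ∫⁻ t in Ioi 0, v t := by
  have hvm := hv.measurable_mk
  have hmk : ∀ t ∈ Ioi (0 : ℝ), ∫⁻ s in S, k s * v (t * s) = ∫⁻ s in S, k s * hv.mk v (t * s) :=
    fun t ht => lintegral_congr_ae <| (ae_restrict_of_ae_restrict_of_subset hSpos
      (ae_restrict_Ioi_comp_mul_left ht hv.ae_eq_mk)).mono fun s hs => by simp only [hs]
  calc ∫⁻ t in Ioi 0, ∫⁻ s in S, k s * v (t * s)
      = ∫⁻ t in Ioi 0, ∫⁻ s in S, k s * hv.mk v (t * s) :=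
        setLIntegral_congr_fun measurableSet_Ioi hmk
    _ = ∫⁻ s in S, ∫⁻ t in Ioi 0, k s * hv.mk v (s * t) := by
        rw [lintegral_lintegral_swap
          (hk.comp_snd.mul (hvm.comp measurable_mul).aemeasurable)]
        simp only [mul_comm]
    _ = ∫⁻ s in S, k s * ENNReal.ofReal s⁻¹ * ∫⁻ t in Ioi 0, v t := by
        refine setLIntegral_congr_fun hS fun s hs => ?_
        rw [lintegral_const_mul _ (by fun_prop), lintegral_Ioi_comp_mul_left _ (hSpos hs),
          mul_assoc, lintegral_congr_ae hv.ae_eq_mk]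
    _ = _ := lintegral_mul_const'' _ (hk.mul measurable_inv.ennreal_ofReal.aemeasurable)

end Dilation

section UpperBound

variable {f h u : ℝ → ℝ} {c s t : ℝ}

/-- The supergradient of `f` along `1 / (c * s)`, which for the right `c` is the extremal profile of
the Hardy inequality: the weight of the linear functional that dominates the mean. -/
def hardyKernel (f : ℝ → ℝ) (c s : ℝ) : ℝ := rightDeriv f (1 / (c * s))

lemma measurable_hardyKernel (f : ℝ → ℝ) (c : ℝ) : Measurable (hardyKernel f c) :=
  (measurable_rightDeriv f).comp (by fun_prop)

lemma hardyKernel_pos (hmono : StrictMonoOn f (Ioi 0)) (hconc : ConcaveOn ℝ (Ioi 0) f)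
    (hc : 0 < c) (hs : 0 < s) : 0 < hardyKernel f c s :=
  rightDeriv_pos hmono hconc (by rw [interior_Ioi]; exact one_div_pos.2 (mul_pos hc hs))

lemma hardyKernel_le (hconc : ConcaveOn ℝ (Ioi 0) f) (hc : 0 < c) (hs : s ∈ Ioo (0 : ℝ) 1) :
    hardyKernel f c s ≤ rightDeriv f (1 / c) := by
  refine antitoneOn_rightDeriv hconc (by simpa using hc) ?_ ?_
  · rw [interior_Ioi]
    exact one_div_pos.2 (mul_pos hc hs.1)
  · exact one_div_le_one_div_of_le (mul_pos hc hs.1) (mul_le_of_le_one_right hc.le hs.2.le)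

lemma integrableOn_hardyKernel_mul (hmono : StrictMonoOn f (Ioi 0))
    (hconc : ConcaveOn ℝ (Ioi 0) f) (hc : 0 < c) (hh : IntegrableOn h (Ioo 0 1)) :
    IntegrableOn (fun s => hardyKernel f c s * h s) (Ioo 0 1) := by
  refine Integrable.bdd_mul (c := rightDeriv f (1 / c)) hh
    (measurable_hardyKernel f c).aestronglyMeasurable ?_
  filter_upwards [ae_restrict_mem measurableSet_Ioo] with s hs
  rw [Real.norm_eq_abs, abs_of_pos (hardyKernel_pos hmono hconc hc hs.1)]
  exact hardyKernel_le hconc hc hs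

lemma rightDeriv_mul_self_le (hmono : StrictMonoOn f (Ioi 0)) (hconc : ConcaveOn ℝ (Ioi 0) f)
    (hone : f 1 = 0) {p : ℝ} (hp : 0 < p) :
    rightDeriv f p * p ≤ 2 * |f p| + 2 * rightDeriv f p := by
  have hpos : 0 < rightDeriv f p := rightDeriv_pos hmono hconc (by simpa using hp)
  rcases le_total p 2 with hle | hge
  · nlinarith [abs_nonneg (f p)]
  · have htangent := le_add_rightDeriv_mul hconc (by simpa using hp) (mem_Ioi.2 one_pos)
    rw [hone] at htangent
    nlinarith [le_abs_self (f p), mul_nonneg hpos.le (sub_nonneg.2 hge)]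

lemma integrableOn_hardyKernel_mul_one_div (hmono : StrictMonoOn f (Ioi 0))
    (hconc : ConcaveOn ℝ (Ioi 0) f) (hone : f 1 = 0)
    (hint : IntegrableOn (fun t => f (1 / t)) (Ioo 0 1)) (hc : 0 < c) :
    IntegrableOn (fun s => hardyKernel f c s * (1 / (c * s))) (Ioo 0 1) := by
  have hbound : IntegrableOn (fun s => 2 * |f (1 / (c * s))| + 2 * rightDeriv f (1 / c))
      (Ioo 0 1) :=
    ((integrableOn_comp_one_div_mul hconc hint hc).abs.const_mul 2).add
      (integrableOn_const (by simp))
  refine hbound.mono' ?_ ?_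
  · exact ((measurable_hardyKernel f c).mul (by fun_prop)).aestronglyMeasurable
  · filter_upwards [ae_restrict_mem measurableSet_Ioo] with s hs
    have hp : 0 < 1 / (c * s) := one_div_pos.2 (mul_pos hc hs.1)
    rw [Real.norm_eq_abs, abs_of_pos (mul_pos (hardyKernel_pos hmono hconc hc hs.1) hp)]
    refine (rightDeriv_mul_self_le hmono hconc hone hp).trans ?_
    gcongr
    exact hardyKernel_le hconc hc hs

lemma integral_hardyKernel_mul_one_div_pos (hmono : StrictMonoOn f (Ioi 0))
    (hconc : ConcaveOn ℝ (Ioi 0) f) (hone : f 1 = 0)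
    (hint : IntegrableOn (fun t => f (1 / t)) (Ioo 0 1)) (hc : 0 < c) :
    0 < ∫ s in Ioo 0 1, hardyKernel f c s * (1 / (c * s)) :=
  setIntegral_pos measurableSet_Ioo (by simp)
    (integrableOn_hardyKernel_mul_one_div hmono hconc hone hint hc) fun _ hs =>
      mul_pos (hardyKernel_pos hmono hconc hc hs.1) (one_div_pos.2 (mul_pos hc hs.1))

-- Integrate the tangent inequality of `f` at `1 / (c * s)`, evaluated at `g s / m` for the mean `m`
-- of `g`: the integrals of both `f (g s / m)` and `f (1 / (c * s))` vanish.
lemma SimpleFn.mean_mul_integral_le (hmono : StrictMonoOn f (Ioi 0))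
    (hconc : ConcaveOn ℝ (Ioi 0) f) (hone : f 1 = 0)
    (hint : IntegrableOn (fun t => f (1 / t)) (Ioo 0 1)) (hc : 0 < c)
    (hzero : ∫ t in (0 : ℝ)..c, f (1 / t) = 0) (g : SimpleFn (Ioi 0) 0 1) :
    g.mean (homogeneousMean f) * ∫ s in Ioo 0 1, hardyKernel f c s * (1 / (c * s)) ≤
      ∫ s in Ioo 0 1, hardyKernel f c s * g.toFun s := by
  obtain ⟨hm, hmean⟩ := g.mean_spec (isDeviation_div hmono hconc hone) ordConnected_Ioi one_pos
  set m := g.mean (homogeneousMean f)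
  have hm : 0 < m := hm
  have hf := integrableOn_comp_one_div_mul hconc hint hc
  have hk := integrableOn_hardyKernel_mul_one_div hmono hconc hone hint hc
  have hkg : IntegrableOn (fun s => m⁻¹ * (hardyKernel f c s * g.toFun s)) (Ioo 0 1) :=
    (integrableOn_hardyKernel_mul hmono hconc hc (g.integrableOn_comp id)).const_mul m⁻¹
  have hfkg : IntegrableOn (fun s => f (1 / (c * s)) + m⁻¹ * (hardyKernel f c s * g.toFun s))
      (Ioo 0 1) := hf.add hkg
  have hle : ∫ s in Ioo 0 1, f (g.toFun s / m) ≤ ∫ s in Ioo 0 1, (f (1 / (c * s)) +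
      m⁻¹ * (hardyKernel f c s * g.toFun s) - hardyKernel f c s * (1 / (c * s))) := by
    refine setIntegral_mono_on (g.integrableOn_comp fun v => f (v / m)) (hfkg.sub hk)
      measurableSet_Ioo fun s hs => ?_
    have hp : 1 / (c * s) ∈ interior (Ioi (0 : ℝ)) := by
      rw [interior_Ioi]
      exact one_div_pos.2 (mul_pos hc hs.1)
    refine (le_add_rightDeriv_mul hconc hp
      (div_pos (g.toFun_mem (Ioo_subset_Ico_self hs)) hm)).trans_eq ?_
    rw [hardyKernel]
    ring
  rw [hmean, integral_sub hfkg hk, integral_add hf hkg, integral_comp_one_div_mul f hc.ne',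
    hzero, integral_const_mul, mul_zero, zero_add, sub_nonneg, ← div_eq_inv_mul,
    le_div_iff₀ hm] at hle
  rwa [mul_comm]

lemma upperMean_le_integral_hardyKernel (hmono : StrictMonoOn f (Ioi 0))
    (hconc : ConcaveOn ℝ (Ioi 0) f) (hone : f 1 = 0)
    (hint : IntegrableOn (fun t => f (1 / t)) (Ioo 0 1)) (hc : 0 < c)
    (hzero : ∫ t in (0 : ℝ)..c, f (1 / t) = 0) (ht : 0 < t) (hu : IntegrableOn u (Ico 0 t)) :
    upperMean (homogeneousMean f) (Ioi 0) u t ≤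
      (((∫ s in Ioo 0 1, hardyKernel f c s * u (t * s)) /
        ∫ s in Ioo 0 1, hardyKernel f c s * (1 / (c * s)) : ℝ) : EReal) := by
  have hKpos := integral_hardyKernel_mul_one_div_pos hmono hconc hone hint hc
  have hr := integrableOn_rescale ht hu
  set K := ∫ s in Ioo 0 1, hardyKernel f c s * (1 / (c * s))
  set L := rightDeriv f (1 / c)
  have hL : 0 < L := rightDeriv_pos hmono hconc (by simpa using hc)
  refine EReal.le_of_forall_lt_iff_le.1 fun r hlt => ?_
  rw [EReal.coe_lt_coe_iff, div_lt_iff₀ hKpos, ← sub_pos] at hlt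
  refine iInf₂_le_of_le _ (div_pos hlt hL) (iSup₂_le fun g hg => EReal.coe_le_coe_iff.2 ?_)
  have hclose := abs_integral_sub_le_of_mem_vicinity hr
    (integrableOn_hardyKernel_mul hmono hconc hc (g.integrableOn_comp id))
    (integrableOn_hardyKernel_mul hmono hconc hc hr) hg hL.le fun s hs => by
      rw [← mul_sub, abs_mul, abs_of_pos (hardyKernel_pos hmono hconc hc hs.1), abs_sub_comm]
      exact mul_le_mul_of_nonneg_right (hardyKernel_le hconc hc hs) (abs_nonneg _)
  rw [mul_div_cancel₀ _ hL.ne'] at hclose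
  have hupper := (abs_le.1 hclose).2
  simp only [rescale, id] at hupper
  refine le_of_mul_le_mul_right
    ((g.mean_mul_integral_le hmono hconc hone hint hc hzero).trans ?_) hKpos
  linarith

lemma lintegral_hardyKernel_mul_inv (hmono : StrictMonoOn f (Ioi 0))
    (hconc : ConcaveOn ℝ (Ioi 0) f) (hone : f 1 = 0)
    (hint : IntegrableOn (fun t => f (1 / t)) (Ioo 0 1)) (hc : 0 < c) :
    ∫⁻ s in Ioo 0 1, ENNReal.ofReal (hardyKernel f c s) * ENNReal.ofReal s⁻¹ =
      ENNReal.ofReal (c * ∫ s in Ioo 0 1, hardyKernel f c s * (1 / (c * s))) := by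
  have hrw : ∀ s, c * (hardyKernel f c s * (1 / (c * s))) = hardyKernel f c s * s⁻¹ := fun s => by
    rw [one_div, mul_inv, mul_left_comm, mul_inv_cancel_left₀ hc.ne']
  have hintc := (integrableOn_hardyKernel_mul_one_div hmono hconc hone hint hc).const_mul c
  simp only [hrw] at hintc
  rw [← integral_const_mul]
  simp only [hrw]
  exact (ofReal_setIntegral_mul measurableSet_Ioo
    (fun s hs => (hardyKernel_pos hmono hconc hc hs.1).le) (fun s hs => (inv_pos.2 hs.1).le)
    hintc).symm

lemma toENNReal_upperMean_le (hmono : StrictMonoOn f (Ioi 0))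
    (hconc : ConcaveOn ℝ (Ioi 0) f) (hone : f 1 = 0)
    (hint : IntegrableOn (fun t => f (1 / t)) (Ioo 0 1)) (hc : 0 < c)
    (hzero : ∫ t in (0 : ℝ)..c, f (1 / t) = 0) (ht : 0 < t) (hu : IntegrableOn u (Ico 0 t))
    (hu0 : ∀ x ∈ Ioo 0 t, 0 ≤ u x) :
    (upperMean (homogeneousMean f) (Ioi 0) u t).toENNReal ≤
      (∫⁻ s in Ioo 0 1, ENNReal.ofReal (hardyKernel f c s) * ENNReal.ofReal (u (t * s))) /
        ENNReal.ofReal (∫ s in Ioo 0 1, hardyKernel f c s * (1 / (c * s))) := by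
  have hK := integral_hardyKernel_mul_one_div_pos hmono hconc hone hint hc
  refine (EReal.toENNReal_le_toENNReal (upperMean_le_integral_hardyKernel hmono hconc hone hint hc
    hzero ht hu)).trans_eq ?_
  rw [EReal.toENNReal_of_ne_top (EReal.coe_ne_top _), EReal.toReal_coe,
    ENNReal.ofReal_div_of_pos hK, ofReal_setIntegral_mul measurableSet_Ioo
      (fun s hs => (hardyKernel_pos hmono hconc hc hs.1).le)
      (fun s hs => hu0 _ ⟨mul_pos ht hs.1, (mul_lt_iff_lt_one_right ht).2 hs.2⟩)
      (integrableOn_hardyKernel_mul hmono hconc hc (integrableOn_rescale ht hu))]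

lemma lintegral_upperMean_le (hmono : StrictMonoOn f (Ioi 0))
    (hconc : ConcaveOn ℝ (Ioi 0) f) (hone : f 1 = 0)
    (hint : IntegrableOn (fun t => f (1 / t)) (Ioo 0 1)) (hc : 0 < c)
    (hzero : ∫ t in (0 : ℝ)..c, f (1 / t) = 0) (hu : IntegrableOn u (Ici 0))
    (hu0 : ∀ x, 0 < x → 0 ≤ u x) :
    ∫⁻ t in Ioi 0, (upperMean (homogeneousMean f) (Ioi 0) u t).toENNReal ≤
      ENNReal.ofReal c * ∫⁻ t in Ioi 0, ENNReal.ofReal (u t) := by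
  have hK := integral_hardyKernel_mul_one_div_pos hmono hconc hone hint hc
  have hk_inv := lintegral_hardyKernel_mul_inv hmono hconc hone hint hc
  set k := fun s => ENNReal.ofReal (hardyKernel f c s)
  set K := ∫ s in Ioo 0 1, hardyKernel f c s * (1 / (c * s))
  have hk_meas : Measurable k := (measurable_hardyKernel f c).ennreal_ofReal
  calc ∫⁻ t in Ioi 0, (upperMean (homogeneousMean f) (Ioi 0) u t).toENNReal
      ≤ ∫⁻ t in Ioi 0, (∫⁻ s in Ioo 0 1, k s * ENNReal.ofReal (u (t * s))) / ENNReal.ofReal K :=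
        setLIntegral_mono' measurableSet_Ioi fun t ht =>
          toENNReal_upperMean_le hmono hconc hone hint hc hzero ht
            (hu.mono_set Ico_subset_Ici_self) fun x hx => hu0 x hx.1
    _ = (∫⁻ t in Ioi 0, ∫⁻ s in Ioo 0 1, k s * ENNReal.ofReal (u (t * s))) / ENNReal.ofReal K := by
        simp only [div_eq_mul_inv]
        exact lintegral_mul_const' _ _ (ENNReal.inv_ne_top.2 (ENNReal.ofReal_pos.2 hK).ne')
    _ = ENNReal.ofReal (c * K) * (∫⁻ t in Ioi 0, ENNReal.ofReal (u t)) / ENNReal.ofReal K := by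
        rw [lintegral_lintegral_mul_comp_mul (v := fun x => ENNReal.ofReal (u x)) measurableSet_Ioo
          Ioo_subset_Ioi_self hk_meas.aemeasurable
          (hu.mono_set Ioi_subset_Ici_self).aemeasurable.ennreal_ofReal, hk_inv]
    _ = ENNReal.ofReal c * ∫⁻ t in Ioi 0, ENNReal.ofReal (u t) := by
        rw [ENNReal.mul_div_right_comm, ← ENNReal.ofReal_div_of_pos hK,
          mul_div_cancel_right₀ _ hK.ne']

end UpperBound

section LowerBound

variable {f : ℝ → ℝ} {b p t y η : ℝ}

lemma exists_integral_comp_one_div_pos_of_integrableOn (hconc : ConcaveOn ℝ (Ioi 0) f)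
    (hint : IntegrableOn (fun t => f (1 / t)) (Ioo 0 1)) (hy : 0 < y)
    (hpos : 0 < ∫ t in (0 : ℝ)..y, f (1 / t)) :
    ∃ η ∈ Ioc (0 : ℝ) 1, 0 < ∫ t in η..y, f (1 / t) := by
  have hprim := intervalIntegral.continuousOn_primitive_interval'
    (intervalIntegrable_comp_one_div hconc hint one_pos) left_mem_uIcc
  rw [uIcc_of_le zero_le_one] at hprim
  have hlim : Tendsto (fun η => ∫ t in (0 : ℝ)..η, f (1 / t)) (𝓝[>] 0) (𝓝 0) := by
    have hzero := (hprim 0 (left_mem_Icc.2 zero_le_one)).mono Ioc_subset_Icc_self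
    rwa [ContinuousWithinAt, intervalIntegral.integral_same,
      nhdsWithin_Ioc_eq_nhdsGT one_pos] at hzero
  obtain ⟨η, hlt, hη⟩ := ((hlim.eventually_lt_const hpos).and (Ioc_mem_nhdsGT one_pos)).exists
  refine ⟨η, hη, ?_⟩
  rw [← intervalIntegral.integral_interval_sub_left
    (intervalIntegrable_comp_one_div hconc hint hy)
    (intervalIntegrable_comp_one_div hconc hint hη.1)]
  exact sub_pos.2 hlt

lemma exists_integral_comp_one_div_pos_of_not_integrableOn (hmono : StrictMonoOn f (Ioi 0))
    (hconc : ConcaveOn ℝ (Ioi 0) f) (hone : f 1 = 0)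
    (hint : ¬ IntegrableOn (fun t => f (1 / t)) (Ioo 0 1)) (hy : 0 < y) :
    ∃ η ∈ Ioc (0 : ℝ) 1, 0 < ∫ t in η..y, f (1 / t) := by
  by_contra! hle
  have hcont : ∀ a b : ℝ, 0 < a → 0 < b → IntervalIntegrable (fun t => f (1 / t)) volume a b :=
    fun a b ha hb => ((continuousOn_comp_one_div hconc).mono fun t ht =>
      (lt_min ha hb).trans_le ht.1).intervalIntegrable
  refine hint (IntegrableOn.mono_set ?_ Ioo_subset_Ioc_self)
  have hnorm : ∀ η ∈ Ioc (0 : ℝ) 1, ∀ t ∈ Ioc η 1, ‖f (1 / t)‖ = f (1 / t) := fun η hη t ht => by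
    have ht0 : 0 < t := hη.1.trans ht.1
    exact Real.norm_of_nonneg (hone.symm.trans_le (hmono.monotoneOn (mem_Ioi.2 one_pos)
      (one_div_pos.2 ht0) ((one_le_div ht0).2 ht.2)))
  have hcut : ∀ n : ℕ, 1 / ((n : ℝ) + 1) ∈ Ioc (0 : ℝ) 1 := fun n =>
    ⟨Nat.one_div_pos_of_nat, div_le_one_of_le₀ (by simp) (by positivity)⟩
  refine integrableOn_Ioc_of_intervalIntegral_norm_bounded_left
    (I := -∫ t in (1 : ℝ)..y, f (1 / t)) (fun n =>
      (intervalIntegrable_iff_integrableOn_Ioc_of_le (hcut n).2).1 (hcont _ 1 (hcut n).1 one_pos))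
    tendsto_one_div_add_atTop_nhds_zero_nat (Eventually.of_forall fun n => ?_)
  have hη := hcut n
  have hsum := intervalIntegral.integral_add_adjacent_intervals
    (hcont _ 1 hη.1 one_pos) (hcont 1 y one_pos hy)
  rw [setIntegral_congr_fun measurableSet_Ioc (hnorm _ hη), ← intervalIntegral.integral_of_le hη.2]
  linarith only [hsum, hle _ hη]

lemma continuous_comp_one_div_max (hconc : ConcaveOn ℝ (Ioi 0) f) (hb : 0 < b) :
    Continuous fun t => f (1 / max t b) :=
  (continuousOn_comp_one_div hconc).comp_continuous (by fun_prop) fun _ => lt_max_of_lt_right hb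

lemma integral_comp_one_div_max_pos (hmono : StrictMonoOn f (Ioi 0))
    (hconc : ConcaveOn ℝ (Ioi 0) f) (hone : f 1 = 0) (hb : 0 < b) (hbη : b ≤ η) (hη : η ≤ 1)
    (hy : 1 ≤ y) (hpos : 0 < ∫ t in η..y, f (1 / t)) :
    0 < ∫ t in (0 : ℝ)..y, f (1 / max t b) := by
  have hint := (continuous_comp_one_div_max hconc hb).intervalIntegrable (μ := volume)
  rw [← intervalIntegral.integral_add_adjacent_intervals (hint 0 η) (hint η y)]
  refine add_pos_of_nonneg_of_pos ?_ ?_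
  · refine intervalIntegral.integral_nonneg (hb.le.trans hbη) fun t ht => hone.symm.trans_le ?_
    have hmax : 0 < max t b := lt_max_of_lt_right hb
    exact hmono.monotoneOn (mem_Ioi.2 one_pos) (one_div_pos.2 hmax)
      ((one_le_div hmax).2 ((max_le ht.2 hbη).trans hη))
  · rwa [intervalIntegral.integral_congr (g := fun t => f (1 / t)) fun t ht => ?_]
    rw [uIcc_of_le (hη.trans hy)] at ht
    simp only [max_eq_left (hbη.trans ht.1)]

/-- The function that is `1` up to `1` and `s ^ (-p)` from there on. As `p` decreases to `1` it
becomes a near-extremal test function for the Hardy inequality; the extremal `1 / s` itself is not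
integrable. -/
def powerTail (p s : ℝ) : ℝ := max s 1 ^ (-p)

lemma powerTail_pos (p s : ℝ) : 0 < powerTail p s :=
  Real.rpow_pos_of_pos (lt_max_of_lt_right one_pos) _

lemma continuous_powerTail (p : ℝ) : Continuous (powerTail p) :=
  Continuous.rpow_const (by fun_prop) fun _ => Or.inl (lt_max_of_lt_right one_pos).ne'

lemma powerTail_of_one_le {s : ℝ} (hs : 1 ≤ s) : powerTail p s = s ^ (-p) := by
  rw [powerTail, max_eq_left hs]

lemma powerTail_of_le_one {s : ℝ} (hs : s ≤ 1) : powerTail p s = 1 := by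
  rw [powerTail, max_eq_right hs, Real.one_rpow]

lemma integrableOn_powerTail (hp : 1 < p) : IntegrableOn (powerTail p) (Ici 0) := by
  rw [← Icc_union_Ioi_eq_Ici zero_le_one]
  refine (continuous_powerTail p).integrableOn_Icc.union ?_
  exact (integrableOn_Ioi_rpow_of_lt (neg_lt_neg hp) one_pos).congr_fun
    (fun s hs => (powerTail_of_one_le (mem_Ioi.1 hs).le).symm) measurableSet_Ioi

lemma integral_powerTail (hp : 1 < p) : ∫ s in Ioi 0, powerTail p s = p / (p - 1) := by
  have hint := integrableOn_powerTail hp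
  have hp' : p - 1 ≠ 0 := (sub_pos.2 hp).ne'
  rw [← Ioc_union_Ioi_eq_Ioi zero_le_one, setIntegral_union (Ioc_disjoint_Ioi le_rfl)
    measurableSet_Ioi (hint.mono_set fun s hs => hs.1.le)
    (hint.mono_set fun s hs => zero_le_one.trans (mem_Ioi.1 hs).le),
    setIntegral_congr_fun measurableSet_Ioc fun s hs => powerTail_of_le_one hs.2,
    setIntegral_congr_fun measurableSet_Ioi fun s hs => powerTail_of_one_le (mem_Ioi.1 hs).le,
    integral_Ioi_rpow_of_lt (neg_lt_neg hp) one_pos, Real.one_rpow]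
  simp only [integral_const, measureReal_restrict_apply_univ,
    Real.volume_real_Ioc_of_le zero_le_one, sub_zero, one_smul]
  rw [neg_add_eq_sub, ← neg_sub p 1, neg_div_neg_eq, one_add_div hp', sub_add_cancel]

lemma lintegral_powerTail (hp : 1 < p) :
    ∫⁻ s in Ioi 0, ENNReal.ofReal (powerTail p s) = ENNReal.ofReal (p / (p - 1)) := by
  rw [← integral_powerTail hp, ofReal_integral_eq_lintegral_ofReal
    ((integrableOn_powerTail hp).mono_set Ioi_subset_Ici_self)
    (ae_of_all _ fun s => (powerTail_pos p s).le)]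

-- Since `max s t⁻¹ ≤ 1`, raising the exponent from `1` to `p` only increases the integrand.
lemma one_div_max_le_rescale_powerTail_div (hp : 1 ≤ p) (hy : 0 < y) (ht : 1 ≤ t) {s : ℝ}
    (hs : s ≤ 1) :
    1 / max (y * s) (y / t) ≤ rescale (powerTail p) t s / (y * t ^ (-p)) := by
  have ht0 : 0 < t := one_pos.trans_le ht
  have hmax : max (y * s) (y / t) = y * max s t⁻¹ := by
    rw [mul_max_of_nonneg _ _ hy.le, div_eq_mul_inv]
  have hscale : max (t * s) 1 = t * max s t⁻¹ := by
    rw [mul_max_of_nonneg _ _ ht0.le, mul_inv_cancel₀ ht0.ne']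
  have hm : 0 < max s t⁻¹ := lt_max_of_lt_right (inv_pos.2 ht0)
  rw [rescale, powerTail, hscale, hmax, Real.mul_rpow ht0.le hm.le, mul_comm (t ^ _),
    mul_div_mul_right _ _ (Real.rpow_pos_of_pos ht0 _).ne', one_div, mul_inv, ← div_eq_inv_mul,
    ← Real.rpow_neg_one]
  gcongr ?_ / y
  exact Real.rpow_le_rpow_of_exponent_ge hm (max_le hs (inv_le_one_of_one_le₀ ht)) (neg_le_neg hp)

lemma le_lowerMean_powerTail (hmono : StrictMonoOn f (Ioi 0))
    (hconc : ConcaveOn ℝ (Ioi 0) f) (hone : f 1 = 0) (hη : η ∈ Ioc (0 : ℝ) 1) (hy : 1 ≤ y)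
    (hpos : 0 < ∫ t in η..y, f (1 / t)) (hp : 1 ≤ p) (ht : y / η ≤ t) :
    ((y * t ^ (-p) : ℝ) : EReal) ≤ lowerMean (homogeneousMean f) (Ioi 0) (powerTail p) t := by
  have hy0 : 0 < y := one_pos.trans_le hy
  have ht1 : 1 ≤ t := ((one_le_div hη.1).2 (hη.2.trans hy)).trans ht
  have ht0 : 0 < t := one_pos.trans_le ht1
  have hb : 0 < y / t := div_pos hy0 ht0
  have hp0 : 0 ≤ p := zero_le_one.trans hp
  have ha : ∀ x ∈ Ico 0 t, t ^ (-p) ≤ powerTail p x := fun x hx =>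
    Real.rpow_le_rpow_of_nonpos (lt_max_of_lt_right one_pos) (max_le hx.2.le ht1) (neg_nonpos.2 hp0)
  have htp : 0 < t ^ (-p) := Real.rpow_pos_of_pos ht0 _
  have hu : IntegrableOn (powerTail p) (Ico 0 t) :=
    (continuous_powerTail p).integrableOn_Icc.mono_set Ico_subset_Icc_self
  refine le_lowerMean hmono hconc hone ht0 hu htp ha (mul_pos hy0 htp) ?_
  have hmain : 0 < ∫ s in Ioo 0 1, f (1 / max (y * s) (y / t)) := by
    rw [← integral_Ioc_eq_integral_Ioo, ← intervalIntegral.integral_of_le zero_le_one,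
      intervalIntegral.integral_comp_mul_left (fun z => f (1 / max z (y / t))) hy0.ne', mul_zero,
      mul_one, smul_eq_mul]
    exact mul_pos (inv_pos.2 hy0) (integral_comp_one_div_max_pos hmono hconc hone hb
      ((div_le_comm₀ hη.1 ht0).1 ht) hη.2 hy hpos)
  refine hmain.trans_le (setIntegral_mono_on ?_ (integrableOn_comp_div hmono hconc
    (integrableOn_rescale ht0 hu) htp (rescale_mem (K := Ici _) ht0 ha) (mul_pos hy0 htp))
    measurableSet_Ioo fun s hs => ?_)
  · exact ((continuous_comp_one_div_max hconc hb).comp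
      (continuous_const_mul y)).integrableOn_Icc.mono_set Ioo_subset_Icc_self
  · exact hmono.monotoneOn (one_div_pos.2 (lt_max_of_lt_right hb))
      (div_pos (powerTail_pos _ _) (mul_pos hy0 htp))
      (one_div_max_le_rescale_powerTail_div hp hy0 ht1 hs.2.le)

lemma ofReal_le_lintegral_lowerMean_powerTail (hmono : StrictMonoOn f (Ioi 0))
    (hconc : ConcaveOn ℝ (Ioi 0) f) (hone : f 1 = 0) (hη : η ∈ Ioc (0 : ℝ) 1) (hy : 1 ≤ y)
    (hpos : 0 < ∫ t in η..y, f (1 / t)) (hp : 1 < p) :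
    ENNReal.ofReal (y * (y / η) ^ (1 - p) / (p - 1)) ≤
      ∫⁻ t in Ioi 0, (lowerMean (homogeneousMean f) (Ioi 0) (powerTail p) t).toENNReal := by
  have hd : 0 < y / η := div_pos (one_pos.trans_le hy) hη.1
  calc ENNReal.ofReal (y * (y / η) ^ (1 - p) / (p - 1))
      = ENNReal.ofReal (∫ t in Ioi (y / η), y * t ^ (-p)) := by
        rw [integral_const_mul, integral_Ioi_rpow_of_lt (neg_lt_neg hp) hd, neg_add_eq_sub,
          mul_div_assoc, neg_div, ← div_neg, neg_sub]
    _ = ∫⁻ t in Ioi (y / η), ENNReal.ofReal (y * t ^ (-p)) := by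
        refine ofReal_integral_eq_lintegral_ofReal
          ((integrableOn_Ioi_rpow_of_lt (neg_lt_neg hp) hd).const_mul y) ?_
        filter_upwards [ae_restrict_mem measurableSet_Ioi] with t ht
        exact mul_nonneg (zero_le_one.trans hy) (Real.rpow_nonneg (hd.trans ht).le _)
    _ ≤ ∫⁻ t in Ioi (y / η),
          (lowerMean (homogeneousMean f) (Ioi 0) (powerTail p) t).toENNReal := by
        refine setLIntegral_mono' measurableSet_Ioi fun t ht => ?_
        have hle := EReal.toENNReal_le_toENNReal
          (le_lowerMean_powerTail hmono hconc hone hη hy hpos hp.le (mem_Ioi.1 ht).le)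
        rwa [EReal.toENNReal_of_ne_top (EReal.coe_ne_top _), EReal.toReal_coe] at hle
    _ ≤ ∫⁻ t in Ioi 0, (lowerMean (homogeneousMean f) (Ioi 0) (powerTail p) t).toENNReal :=
        lintegral_mono_set (Ioi_subset_Ioi hd.le)

end LowerBound

section HardyConstant

lemma mem_of_ae_mem_of_isClosed {Y : Type*} [TopologicalSpace Y] {φ : ℝ → Y} (hφ : Continuous φ)
    {F : Set Y} (hF : IsClosed F) {t : ℝ} (hmem : ∀ᵐ x ∂volume.restrict (Ico 0 t), φ x ∈ F) :
    ∀ x ∈ Ico 0 t, φ x ∈ F := by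
  intro x hx
  have hae : ∀ᵐ x ∂volume.restrict (Ioo 0 t), φ x ∈ F :=
    ae_restrict_of_ae_restrict_of_subset Ioo_subset_Ico_self hmem
  have hopen : IsOpen (Ioo 0 t ∩ (φ ⁻¹' F)ᶜ) :=
    isOpen_Ioo.inter (hF.preimage hφ).isOpen_compl
  have hempty : Ioo 0 t ∩ (φ ⁻¹' F)ᶜ = ∅ := by
    rw [← hopen.measure_eq_zero_iff volume, inter_comm, ← Measure.restrict_apply']
    · exact hae
    · exact measurableSet_Ioo
  have hclosure := closure_minimal (disjoint_compl_right_iff_subset.1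
    (disjoint_iff_inter_eq_empty.2 hempty)) (hF.preimage hφ)
  rw [closure_Ioo (hx.1.trans_lt hx.2).ne] at hclosure
  exact hclosure (Ico_subset_Icc_self hx)

lemma continuous_mem_deepClass {u : ℝ → ℝ} (hu : Continuous u) (hpos : ∀ s, 0 < u s) (t : ℝ) :
    u ∈ deepClass (Ioi 0) t := by
  have hcoe : Continuous fun x => (u x : EReal) := continuous_coe_real_ereal.comp hu
  refine ⟨hu.integrableOn_Icc.mono_set Ico_subset_Icc_self,
    ⟨u '' Icc 0 t, (isPreconnected_Icc.image u hu.continuousOn).ordConnected, ?_,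
      fun x hx => mem_image_of_mem u (Ico_subset_Icc_self hx)⟩, le_antisymm ?_ ?_,
    le_antisymm ?_ ?_⟩
  · rw [(isCompact_Icc.image hu).isClosed.closure_eq, interior_Ioi]
    exact image_subset_iff.2 fun x _ => hpos x
  · refine essSup_le_of_ae_le _ ?_
    filter_upwards [ae_restrict_mem measurableSet_Ico] with x hx
    exact le_iSup₂_of_le x hx le_rfl
  · exact iSup₂_le (mem_of_ae_mem_of_isClosed hcoe isClosed_Iic
      (ae_le_essSup (f := fun x => (u x : EReal)) (μ := volume.restrict (Ico 0 t))))
  · exact le_iInf₂ (mem_of_ae_mem_of_isClosed hcoe isClosed_Ici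
      (ae_essInf_le (f := fun x => (u x : EReal)) (μ := volume.restrict (Ico 0 t))))
  · refine le_essInf_of_ae_le _ ?_
    filter_upwards [ae_restrict_mem measurableSet_Ico] with x hx
    exact iInf₂_le_of_le x hx le_rfl

variable {f : ℝ → ℝ} {X : ℝ → Set (ℝ → ℝ)} {𝔐 : (ℝ → ℝ) → ℝ → EReal} {c η y : ℝ}

lemma hardyConst_le (hmono : StrictMonoOn f (Ioi 0)) (hconc : ConcaveOn ℝ (Ioi 0) f)
    (hone : f 1 = 0)
    (hupper : ∀ t, 0 < t → ∀ u ∈ X t, 𝔐 u t ≤ upperMean (homogeneousMean f) (Ioi 0) u t)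
    (hint : IntegrableOn (fun t => f (1 / t)) (Ioo 0 1)) (hc : 0 < c)
    (hzero : ∫ t in (0 : ℝ)..c, f (1 / t) = 0) :
    hardyConst (Ioi 0) X 𝔐 ≤ ENNReal.ofReal c :=
  sInf_le fun u hpos hu hX => calc
    ∫⁻ t in Ioi 0, (𝔐 u t).toENNReal
      ≤ ∫⁻ t in Ioi 0, (upperMean (homogeneousMean f) (Ioi 0) u t).toENNReal :=
        setLIntegral_mono' measurableSet_Ioi fun t ht =>
          EReal.toENNReal_le_toENNReal (hupper t ht u (hX t ht))
    _ ≤ ENNReal.ofReal c * ∫⁻ t in Ioi 0, ENNReal.ofReal (u t) :=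
        lintegral_upperMean_le hmono hconc hone hint hc hzero hu fun x hx => (hpos x hx.le).le

lemma ofReal_le_of_forall_mul_rpow_le {C : ℝ≥0∞} {d : ℝ} (hd : 0 < d)
    (hle : ∀ p : ℝ, 1 < p → ENNReal.ofReal (y * d ^ (1 - p)) ≤ C * ENNReal.ofReal p) :
    ENNReal.ofReal y ≤ C := by
  have hleft : Tendsto (fun p : ℝ => ENNReal.ofReal (y * d ^ (1 - p))) (𝓝[>] 1)
      (𝓝 (ENNReal.ofReal y)) := by
    have hcont : Continuous fun p : ℝ => ENNReal.ofReal (y * d ^ (1 - p)) :=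
      ENNReal.continuous_ofReal.comp
        (continuous_const.mul (continuous_const.rpow (by fun_prop) fun _ => Or.inl hd.ne'))
    simpa using (hcont.tendsto 1).mono_left nhdsWithin_le_nhds
  have hright : Tendsto (fun p : ℝ => C * ENNReal.ofReal p) (𝓝[>] 1) (𝓝 C) := by
    simpa using ENNReal.Tendsto.const_mul
      ((ENNReal.continuous_ofReal.tendsto 1).mono_left nhdsWithin_le_nhds) (Or.inl (by simp))
  exact le_of_tendsto_of_tendsto hleft hright (eventually_mem_nhdsWithin.mono hle)

lemma ofReal_le_hardyConst (hmono : StrictMonoOn f (Ioi 0)) (hconc : ConcaveOn ℝ (Ioi 0) f)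
    (hone : f 1 = 0)
    (hX : ∀ t, 0 < t → ∀ u : ℝ → ℝ, Continuous u → (∀ s, 0 < u s) → u ∈ X t)
    (hlower : ∀ t, 0 < t → ∀ u ∈ X t, lowerMean (homogeneousMean f) (Ioi 0) u t ≤ 𝔐 u t)
    (hη : η ∈ Ioc (0 : ℝ) 1) (hy : 1 ≤ y) (hpos : 0 < ∫ t in η..y, f (1 / t)) :
    ENNReal.ofReal y ≤ hardyConst (Ioi 0) X 𝔐 := by
  refine le_sInf fun C hC => ?_
  have hd : 0 < y / η := div_pos (one_pos.trans_le hy) hη.1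
  refine ofReal_le_of_forall_mul_rpow_le hd fun p hp => ?_
  have hmem : ∀ t, 0 < t → powerTail p ∈ X t := fun t ht =>
    hX t ht _ (continuous_powerTail p) (powerTail_pos p)
  have hp0 : 0 < p - 1 := sub_pos.2 hp
  have hhardy := calc
    ENNReal.ofReal (y * (y / η) ^ (1 - p) / (p - 1))
      ≤ ∫⁻ t in Ioi 0, (lowerMean (homogeneousMean f) (Ioi 0) (powerTail p) t).toENNReal :=
        ofReal_le_lintegral_lowerMean_powerTail hmono hconc hone hη hy hpos hp
    _ ≤ ∫⁻ t in Ioi 0, (𝔐 (powerTail p) t).toENNReal :=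
        setLIntegral_mono' measurableSet_Ioi fun t ht =>
          EReal.toENNReal_le_toENNReal (hlower t ht _ (hmem t ht))
    _ ≤ C * ENNReal.ofReal (p / (p - 1)) := by
        rw [← lintegral_powerTail hp]
        exact hC _ (fun t _ => powerTail_pos p t) (integrableOn_powerTail hp) hmem
  have hne : ENNReal.ofReal (p - 1) ≠ 0 := (ENNReal.ofReal_pos.2 hp0).ne'
  rwa [ENNReal.ofReal_div_of_pos hp0, ENNReal.ofReal_div_of_pos hp0, ← mul_div_assoc,
    ENNReal.div_le_iff hne ENNReal.ofReal_ne_top,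
    ENNReal.div_mul_cancel hne ENNReal.ofReal_ne_top] at hhardy

lemma hardyConst_eq_ofReal (hmono : StrictMonoOn f (Ioi 0)) (hconc : ConcaveOn ℝ (Ioi 0) f)
    (hone : f 1 = 0)
    (hX : ∀ t, 0 < t → ∀ u : ℝ → ℝ, Continuous u → (∀ s, 0 < u s) → u ∈ X t)
    (hmean : ∀ t, 0 < t → ∀ u ∈ X t, 𝔐 u t ∈ Icc (lowerMean (homogeneousMean f) (Ioi 0) u t)
      (upperMean (homogeneousMean f) (Ioi 0) u t))
    (hint : IntegrableOn (fun t => f (1 / t)) (Ioo 0 1)) (hc : 0 < c)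
    (hzero : ∫ t in (0 : ℝ)..c, f (1 / t) = 0) :
    hardyConst (Ioi 0) X 𝔐 = ENNReal.ofReal c := by
  refine le_antisymm (hardyConst_le hmono hconc hone (fun t ht u hu => (hmean t ht u hu).2)
    hint hc hzero) (le_of_tendsto
      (ENNReal.continuous_ofReal.continuousWithinAt (s := Iio c)) ?_)
  filter_upwards [Ioo_mem_nhdsLT
    (one_lt_of_integral_comp_one_div_eq_zero hmono hconc hone hint hc hzero)] with y hy
  have hy0 : 0 < y := one_pos.trans hy.1
  have hpos : 0 < ∫ t in (0 : ℝ)..y, f (1 / t) := by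
    have hlt := strictAntiOn_integral_comp_one_div_mul hmono hconc hint hy0 hc hy.2
    simp only [integral_comp_one_div_mul f hc.ne', integral_comp_one_div_mul f hy0.ne', hzero,
      mul_zero] at hlt
    exact (pos_iff_pos_of_mul_pos hlt).1 (inv_pos.2 hy0)
  obtain ⟨η, hη, hηpos⟩ := exists_integral_comp_one_div_pos_of_integrableOn hconc hint hy0 hpos
  exact ofReal_le_hardyConst hmono hconc hone hX (fun t ht u hu => (hmean t ht u hu).1) hη
    hy.1.le hηpos

lemma hardyConst_eq_top (hmono : StrictMonoOn f (Ioi 0)) (hconc : ConcaveOn ℝ (Ioi 0) f)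
    (hone : f 1 = 0)
    (hX : ∀ t, 0 < t → ∀ u : ℝ → ℝ, Continuous u → (∀ s, 0 < u s) → u ∈ X t)
    (hlower : ∀ t, 0 < t → ∀ u ∈ X t, lowerMean (homogeneousMean f) (Ioi 0) u t ≤ 𝔐 u t)
    (hint : ¬ IntegrableOn (fun t => f (1 / t)) (Ioo 0 1)) :
    hardyConst (Ioi 0) X 𝔐 = ⊤ := by
  refine ENNReal.eq_top_of_forall_nnreal_le fun r => ?_
  have hy : (1 : ℝ) ≤ r + 1 := le_add_of_nonneg_left r.2
  obtain ⟨η, hη, hpos⟩ := exists_integral_comp_one_div_pos_of_not_integrableOn hmono hconc hone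
    hint (one_pos.trans_le hy)
  rw [← ENNReal.ofReal_coe_nnreal]
  exact (ENNReal.ofReal_le_ofReal (le_add_of_nonneg_right zero_le_one)).trans
    (ofReal_le_hardyConst hmono hconc hone hX hlower hη hy hpos)

end HardyConstant

end IntegralHardy

end

open IntegralHardy in
theorem mainTheorem5_general (f : ℝ → ℝ)
    (hmono : StrictMonoOn f (Ioi 0)) (hconc : ConcaveOn ℝ (Ioi 0) f) (hone : f 1 = 0) :
    IsDeviation (Ioi 0) (fun x y => f (x / y)) ∧
    (∀ t : ℝ, 0 < t → ∀ h : ℝ → ℝ, IntegrableOn h (Ico 0 t) →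
      (∃ a, 0 < a ∧ ∀ x ∈ Ico 0 t, a ≤ h x) →
      h ∈ meanDomain (homogeneousMean f) (Ioi 0) t) ∧
    ∀ (X : ℝ → Set (ℝ → ℝ)) (𝔐 : (ℝ → ℝ) → ℝ → EReal),
      (∀ t : ℝ, 0 < t → ∀ u : ℝ → ℝ, Continuous u → (∀ s, 0 < u s) → u ∈ X t) →
      (∀ t : ℝ, 0 < t → ∀ u ∈ X t, 𝔐 u t ∈ Icc (lowerMean (homogeneousMean f) (Ioi 0) u t)
        (upperMean (homogeneousMean f) (Ioi 0) u t)) →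
      (hardyConst (Ioi 0) X 𝔐 < ⊤ ↔
        ∫⁻ t in Ioo (0 : ℝ) 1, ENNReal.ofReal (f (1 / t)) < ⊤) ∧
      (∫⁻ t in Ioo (0 : ℝ) 1, ENNReal.ofReal (f (1 / t)) < ⊤ →
        ∃ c : ℝ, 0 < c ∧
          IntervalIntegrable (fun t => f (1 / t)) volume 0 c ∧
          (∫ t in (0 : ℝ)..c, f (1 / t)) = 0 ∧
          (∀ c' : ℝ, 0 < c' → (∫ t in (0 : ℝ)..c', f (1 / t)) = 0 → c' = c) ∧
          hardyConst (Ioi 0) X 𝔐 = ENNReal.ofReal c) := by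
  refine ⟨isDeviation_div hmono hconc hone, fun t ht h hh ⟨a, ha0, ha⟩ =>
    ⟨⟨hh, fun x hx => ha0.trans_le (ha x hx)⟩,
      lowerMean_eq_upperMean hmono hconc hone ht hh ha0 ha⟩, fun X 𝔐 hX hmean => ?_⟩
  rw [lintegral_comp_one_div_lt_top_iff hmono hconc hone]
  refine ⟨⟨fun hfin => ?_, fun hint => ?_⟩, fun hint => ?_⟩
  · by_contra hint
    exact hfin.ne
      (hardyConst_eq_top hmono hconc hone hX (fun t ht u hu => (hmean t ht u hu).1) hint)
  · obtain ⟨c, ⟨hc, hzero⟩, -⟩ :=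
      existsUnique_integral_comp_one_div_eq_zero hmono hconc hone hint
    rw [hardyConst_eq_ofReal hmono hconc hone hX hmean hint hc hzero]
    exact ENNReal.ofReal_lt_top
  · obtain ⟨c, ⟨hc, hzero⟩, hunique⟩ :=
      existsUnique_integral_comp_one_div_eq_zero hmono hconc hone hint
    exact ⟨c, hc, intervalIntegrable_comp_one_div hconc hint hc, hzero,
      fun c' hc' hzero' => hunique c' ⟨hc', hzero'⟩,
      hardyConst_eq_ofReal hmono hconc hone hX hmean hint hc hzero⟩

theorem mainTheorem5 (f : ℝ → ℝ)
    (hmono : StrictMonoOn f (Set.Ioi 0)) (hconc : ConcaveOn ℝ (Set.Ioi 0) f) (hone : f 1 = 0)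
    (E : ℝ → ℝ → ℝ) (hE : ∀ x y : ℝ, E x y = f (x / y))
    (D : IntegralHardy.WeightedMean) (hD : D = IntegralHardy.deviationMean (Set.Ioi 0) E) :
    IntegralHardy.IsDeviation (Set.Ioi 0) E ∧
    (∀ t : ℝ, 0 < t →
      IntegralHardy.deepClass (Set.Ioi 0) t ⊆ IntegralHardy.meanDomain D (Set.Ioi 0) t) ∧
    ∀ X : ℝ → Set (ℝ → ℝ),
      (∀ t : ℝ, 0 < t → IntegralHardy.deepClass (Set.Ioi 0) t ⊆ X t ∧
        X t ⊆ IntegralHardy.meanDomain D (Set.Ioi 0) t) →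
      (IntegralHardy.hardyConst (Set.Ioi 0) X (IntegralHardy.integralMean D (Set.Ioi 0)) < ⊤ ↔
        ∫⁻ t in Set.Ioo (0 : ℝ) 1, ENNReal.ofReal (f (1 / t)) < ⊤) ∧
      (∫⁻ t in Set.Ioo (0 : ℝ) 1, ENNReal.ofReal (f (1 / t)) < ⊤ →
        ∃ c : ℝ, 0 < c ∧
          IntervalIntegrable (fun t => f (1 / t)) MeasureTheory.volume 0 c ∧
          (∫ t in (0 : ℝ)..c, f (1 / t)) = 0 ∧
          (∀ c' : ℝ, 0 < c' → (∫ t in (0 : ℝ)..c', f (1 / t)) = 0 → c' = c) ∧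
          IntegralHardy.hardyConst (Set.Ioi 0) X (IntegralHardy.integralMean D (Set.Ioi 0)) =
            ENNReal.ofReal c) := by
  obtain rfl : E = fun x y => f (x / y) := funext₂ hE
  subst hD
  obtain ⟨hdev, hdom, hhardy⟩ := mainTheorem5_general f hmono hconc hone
  exact ⟨hdev,
    fun t ht h hh => hdom t ht h hh.1 (IntegralHardy.exists_pos_le_of_mem_deepClass hh),
    fun X hX => hhardy X _
      (fun t ht u hu hpos => (hX t ht).1 (IntegralHardy.continuous_mem_deepClass hu hpos t))
      fun t ht u hu => ⟨le_rfl, ((hX t ht).2 hu).2.le⟩⟩
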